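/- Let $X$ be a smooth manifold of dimension $2n$. A divisor ideal $I\subseteq C^\infty(X)$ is the ideal of global sections of a locally principal ideal sheaf whose local generators have nowhere dense zero set. Put $\Gamma(TX)_I=\{V\in\Gamma(TX) : \mathcal L_V I\subseteq I\}$ and let $I$ be projective, i.e. assume that $\Gamma(TX)_I$ is the module of sections of a vector bundle: there is a Lie algebroid $TX_I\to X$ (unique up to isomorphism) whose anchor $\rho$ is injective on sections, with image $\Gamma(TX)_I$. Suppose that every point of $X$ has a neighbourhood on which the dual bundle $TX_I^*$ has a basis of sections that are closed for the Lie algebroid differential. Let $\pi$ be a Poisson structure on $X$ of $I$-divisor-type: $\wedge^n\pi\in\Gamma(\wedge^{2n}TX)$ has nowhere dense zero set, and $\{\langle \wedge^n\pi,\omega\rangle : \omega\in\Omega^{2n}(X)\}=I$. Then $\rho$ is an isomorphism over a dense subset of $X$, and $\pi$ lifts to $TX_I$: there is a unique section $\tilde\pi$ of $\wedge^2 TX_I$ with $(\wedge^2\rho)(\tilde\pi)=\pi$, and $[\tilde\pi,\tilde\pi]_{TX_I}=0$, i.e. $\tilde\pi$ is a $TX_I$-Poisson structure. Moreover, $\tilde\pi$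 is nondegenerate (i.e. $\tilde\pi^\sharp\colon TX_I^*\to TX_I$ is an isomorphism) if and only if $I$ is standard, i.e. $I_{TX_I}=I$, where $I_{TX_I}\subseteq C^\infty(X)$ is the ideal generated by the functions $\omega(\rho v_1,\dots,\rho v_{2n})$ with $v_1,\dots,v_{2n}\in\Gamma(TX_I)$ and $\omega\in\Omega^{2n}(X)$ (the divisor ideal of the section $\det\rho$ of $\det(TX_I^*)\otimes\det(TX)$). -/

import Mathlib

open Bundle Filter Topology
open scoped Manifold ContDiff

noncomputable section

namespace DivType

/-! ### Smooth functions, sections, forms -/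

section Basic

variable (d : ℕ) (X : Type*) [TopologicalSpace X] [ChartedSpace (EuclideanSpace ℝ (Fin d)) X]

/-- The ring `C^∞(X)` of smooth real functions on a `d`-dimensional manifold. -/
abbrev SmoothFun : Type _ := C^∞⟮𝓡 d, X; ℝ⟯

variable {X}
variable (F : Type*) [NormedAddCommGroup F] [NormedSpace ℝ F]
  (E : X → Type*) [TopologicalSpace (TotalSpace F E)] [∀ x, TopologicalSpace (E x)]
  [FiberBundle F E]

/-- The smooth sections `Γ(E)` of a bundle `E → X` with model fibre `F`. -/
abbrev Sec : Type _ := Cₛ^∞⟮𝓡 d; F, E⟯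

variable (X) in
/-- The smooth vector fields `Γ(TX)`. -/
abbrev VF [IsManifold (𝓡 d) ∞ X] : Type _ :=
  Sec d (EuclideanSpace ℝ (Fin d)) (TangentSpace (𝓡 d) : X → Type _)

variable {d F E} [∀ x, AddCommGroup (E x)] [∀ x, Module ℝ (E x)] [VectorBundle ℝ F E]

/-- The product `f · s` of a smooth function and a smooth section. -/
def fsmul (f : SmoothFun d X) (s : Sec d F E) : Sec d F E :=
  ⟨fun x => f x • s x, ContMDiff.smul_section f.contMDiff s.contMDiff⟩

/-- A section of `E^*`, smooth over `U`. A rough section of the dual bundle is smooth if and only if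
its pairing with every smooth section of `E` is a smooth function. -/
def IsSmoothCovectorOn (U : Set X) (α : ∀ x, Module.Dual ℝ (E x)) : Prop :=
  ∀ s : Sec d F E, ContMDiffOn (𝓡 d) 𝓘(ℝ, ℝ) ∞ (fun x => α x (s x)) U

variable [IsManifold (𝓡 d) ∞ X]

/-- Smooth differential `k`-forms on `X`: pointwise alternating `k`-linear forms on the tangent
spaces whose values on smooth vector fields are smooth. -/
def IsSmoothForm {k : ℕ} (η : ∀ x : X, (TangentSpace (𝓡 d) x) [⋀^Fin k]→ₗ[ℝ] ℝ) : Prop :=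
  ∀ v : Fin k → VF d X, ContMDiff (𝓡 d) 𝓘(ℝ, ℝ) ∞ (fun x => η x (fun i => v i x))

end Basic

/-! ### Divisor ideals -/

section Ideals

variable {d : ℕ} {X : Type*} [TopologicalSpace X] [ChartedSpace (EuclideanSpace ℝ (Fin d)) X]

/-- `I` is the ideal of global sections of a locally principal ideal sheaf generated by
nowhere-densely vanishing functions. The sheaf is recovered from `I` as
`U ↦ {f ∈ C^∞(U) | f agrees near each point of U with an element of I}`; the first clause says that
it is locally generated by one function `g` with nowhere dense zero set (the generator and the
quotients can be taken to be globally defined, by bump functions), the second that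
`I` contains all the global sections of this sheaf. -/
structure IsDivisorIdeal (I : Ideal (SmoothFun d X)) : Prop where
  locally_principal : ∀ x : X, ∃ U : Set X, IsOpen U ∧ x ∈ U ∧ ∃ g ∈ I,
    IsNowhereDense {y | y ∈ U ∧ g y = 0} ∧
    ∀ f ∈ I, ∃ h : SmoothFun d X, ∀ y ∈ U, f y = h y * g y
  mem_of_locally : ∀ f : SmoothFun d X,
    (∀ x : X, ∃ g ∈ I, ∀ᶠ y in 𝓝 x, f y = g y) → f ∈ I

variable [IsManifold (𝓡 d) ∞ X]

/-- The vector field `V` preserves `I`, that is `𝓛_V I ⊆ I`; these `V` form `Γ(TX)_I`. -/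
def Preserves (V : VF d X) (I : Ideal (SmoothFun d X)) : Prop :=
  ∀ f ∈ I, ∃ g ∈ I, ∀ x, g x = mvfderiv (𝓡 d) f x (V x)

end Ideals

/-! ### Lie algebroids -/

section Algebroid

variable (d : ℕ) (X : Type*) [TopologicalSpace X] [ChartedSpace (EuclideanSpace ℝ (Fin d)) X]
  [IsManifold (𝓡 d) ∞ X]
  (F : Type*) [NormedAddCommGroup F] [NormedSpace ℝ F]
  (E : X → Type*) [TopologicalSpace (TotalSpace F E)] [∀ x, TopologicalSpace (E x)]
  [∀ x, AddCommGroup (E x)] [∀ x, Module ℝ (E x)] [FiberBundle F E] [VectorBundle ℝ F E]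
  [ContMDiffVectorBundle ∞ F E (𝓡 d)]

/-- A Lie algebroid structure on the smooth vector bundle `E → X`: a smooth bundle map to `TX`
(the anchor) and a Lie bracket on smooth sections satisfying the Leibniz rule. (Homogeneity of the
bracket over `ℝ` is the Leibniz rule for constant functions.) -/
structure LieAlgebroid where
  anchor : ∀ x, E x →ₗ[ℝ] TangentSpace (𝓡 d) x
  anchor_smooth : ContMDiff ((𝓡 d).prod 𝓘(ℝ, F)) (𝓡 d).tangent ∞
    (fun e : TotalSpace F E => (⟨e.proj, anchor e.proj e.2⟩ : TangentBundle (𝓡 d) X))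
  bracket : Sec d F E → Sec d F E → Sec d F E
  bracket_add_left : ∀ u v w, bracket (u + v) w = bracket u w + bracket v w
  bracket_add_right : ∀ u v w, bracket u (v + w) = bracket u v + bracket u w
  bracket_self : ∀ v, bracket v v = 0
  jacobi : ∀ u v w, bracket u (bracket v w) = bracket (bracket u v) w + bracket v (bracket u w)
  leibniz : ∀ (f : SmoothFun d X) (v w : Sec d F E) (x : X),
    bracket v (fsmul f w) x =
      f x • bracket v w x + (mvfderiv (𝓡 d) f x (anchor x (v x))) • w x

/-- The tangent bundle as a Lie algebroid: identity anchor, Lie bracket of vector fields. -/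
def tangent : LieAlgebroid d X (EuclideanSpace ℝ (Fin d)) (TangentSpace (𝓡 d) : X → Type _) where
  anchor _ := LinearMap.id
  anchor_smooth := contMDiff_id
  bracket V W := ⟨VectorField.mlieBracket (𝓡 d) V W, by
    have : IsManifold (𝓡 d) (((⊤ : ℕ∞) : ℕ∞ω) + 1) X := ‹IsManifold (𝓡 d) ∞ X›
    have : IsManifold (𝓡 d) (minSmoothness ℝ 2) X := by
      rw [minSmoothness_of_isRCLikeNormedField]; infer_instance
    have : IsManifold (𝓡 d) (minSmoothness ℝ 3) X := by
      rw [minSmoothness_of_isRCLikeNormedField]; infer_instance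
    exact ContDiff.mlieBracket_vectorField (n := ⊤) V.contMDiff W.contMDiff (by simp)⟩
  bracket_add_left u v w := by
    ext1 x
    have : IsManifold (𝓡 d) 2 X := inferInstance
    exact VectorField.mlieBracket_add_left u.mdifferentiableAt v.mdifferentiableAt
  bracket_add_right u v w := by
    ext1 x
    have : IsManifold (𝓡 d) 2 X := inferInstance
    exact VectorField.mlieBracket_add_right v.mdifferentiableAt w.mdifferentiableAt
  bracket_self v := by
    ext1 x
    exact congrFun VectorField.mlieBracket_self x
  jacobi u v w := by
    ext1 x
    have : IsManifold (𝓡 d) (minSmoothness ℝ 3) X := by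
      rw [minSmoothness_of_isRCLikeNormedField]; infer_instance
    have h : minSmoothness ℝ 2 ≤ ∞ := by
      rw [minSmoothness_of_isRCLikeNormedField]; exact ENat.LEInfty.out
    exact VectorField.leibniz_identity_mlieBracket_apply (u.contMDiff.of_le h x)
      (v.contMDiff.of_le h x) (w.contMDiff.of_le h x)
  leibniz f v w x := by
    have : IsManifold (𝓡 d) 2 X := inferInstance
    have hf : MDifferentiableAt (𝓡 d) 𝓘(ℝ, ℝ) f x := f.contMDiff.mdifferentiableAt (by simp)
    exact (VectorField.mlieBracket_smul_right (V := v) (W := w) hf w.mdifferentiableAt).trans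
      (add_comm _ _)

variable {X F E d}

namespace LieAlgebroid

variable (A : LieAlgebroid d X F E)

/-- `A` is of divisor-type: the locus where the anchor is an isomorphism is dense. -/
def IsDivisorType : Prop := Dense {x | Function.Bijective (A.anchor x)}

/-- The divisor ideal `I_A` of the section `det ρ_A` of `det(A^*) ⊗ det(TX)`: the image of the
evaluation of `det ρ_A` on `Γ(det(A) ⊗ det(T^*X))`. The latter is spanned over `C^∞(X)` by the
sections `(v₁ ∧ ⋯ ∧ v_d) ⊗ ω`, on which the evaluation is `ω(ρ v₁, …, ρ v_d)`. -/
def divisorIdeal : Ideal (SmoothFun d X) :=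
  Ideal.span {f | ∃ (v : Fin d → Sec d F E)
    (η : ∀ x : X, (TangentSpace (𝓡 d) x) [⋀^Fin d]→ₗ[ℝ] ℝ), IsSmoothForm η ∧
    ∀ x, f x = η x (fun i => A.anchor x (v i x))}

/-- `A` is an ideal Lie algebroid `TX_I`: the anchor is injective on sections, with image
`Γ(TX)_I`, so that it identifies `Γ(A)` with `Γ(TX)_I`. -/
def IsIdealLieAlgebroid (I : Ideal (SmoothFun d X)) : Prop :=
  (∀ s t : Sec d F E, (∀ x, A.anchor x (s x) = A.anchor x (t x)) → s = t) ∧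
  ∀ V : VF d X, Preserves V I ↔ ∃ s : Sec d F E, ∀ x, A.anchor x (s x) = V x

/-- The Lie algebroid differential of a local section `α` of `A^*` (Koszul formula):
`(d_A α)(v, w) = ρ(v)(α(w)) - ρ(w)(α(v)) - α([v, w])`. -/
def dOne (α : ∀ x, Module.Dual ℝ (E x)) (v w : Sec d F E) (x : X) : ℝ :=
  mvfderiv (𝓡 d) (fun y => α y (w y)) x (A.anchor x (v x))
    - mvfderiv (𝓡 d) (fun y => α y (v y)) x (A.anchor x (w x))
    - α x (A.bracket v w x)

/-- The dual bundle `A^*` admits local bases of closed sections: every point has an open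
neighbourhood `U` with smooth sections `α₁, …, α_r` of `A^*` over `U`
which are a basis of the fibre at each point of `U` and satisfy `d_A α_i = 0` on `U`. -/
def HasLocalClosedBases : Prop :=
  ∀ x₀ : X, ∃ U : Set X, IsOpen U ∧ x₀ ∈ U ∧
    ∃ (r : ℕ) (α : Fin r → ∀ x, Module.Dual ℝ (E x)),
      (∀ i, IsSmoothCovectorOn (d := d) (F := F) U (α i)) ∧
      (∀ x ∈ U, LinearIndependent ℝ (fun i => α i x) ∧
        Submodule.span ℝ (Set.range fun i => α i x) = ⊤) ∧
      ∀ i, ∀ v w : Sec d F E, ∀ x ∈ U, A.dOne (α i) v w x = 0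

end LieAlgebroid

/-! ### Bivectors -/

variable (d F E) in
/-- A bivector, i.e. a smooth section of `⋀² E`: pointwise an element of `⋀² E_x`, and locally
a finite sum of wedge products of smooth sections. -/
@[ext] structure Bivector where
  toFun : ∀ x, ⋀[ℝ]^2 (E x)
  smooth : ∀ x₀ : X, ∃ (k : ℕ) (v w : Fin k → Sec d F E), ∀ᶠ x in 𝓝 x₀,
    (toFun x : ExteriorAlgebra ℝ (E x)) =
      ∑ i, ExteriorAlgebra.ι ℝ (v i x) * ExteriorAlgebra.ι ℝ (w i x)

namespace Bivector

variable (P : Bivector d F E)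

/-- The map `P^♯ : E_x^* → E_x`, `α ↦ ι_α P`. -/
def sharp (x : X) (α : Module.Dual ℝ (E x)) : E x :=
  ExteriorAlgebra.ιInv
    (CliffordAlgebra.contractLeft (Q := (0 : QuadraticForm ℝ (E x))) α
      (P.toFun x : ExteriorAlgebra ℝ (E x)))

/-- `P` is nondegenerate: `P^♯ : E^* → E` is an isomorphism. -/
def IsNondegenerate : Prop := ∀ x, Function.Bijective (P.sharp x)

/-- The Pfaffian `P^n = P ∧ ⋯ ∧ P`, at the point `x`. -/
def pfaffian (n : ℕ) (x : X) : ⋀[ℝ]^(2 * n) (E x) :=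
  ⟨(P.toFun x : ExteriorAlgebra ℝ (E x)) ^ n, by
    have h := Submodule.pow_mem_pow _ (P.toFun x).2 n
    rwa [← pow_mul] at h⟩

end Bivector

/-- The Schouten bracket `[v ∧ w, v' ∧ w']_A` at `x`, namely
`[v,v'] ∧ w ∧ w' - [v,w'] ∧ w ∧ v' - [w,v'] ∧ v ∧ w' + [w,w'] ∧ v ∧ v'`. -/
def LieAlgebroid.schouten (A : LieAlgebroid d X F E) (v w v' w' : Sec d F E) (x : X) :
    ExteriorAlgebra ℝ (E x) :=
  let e : Sec d F E → ExteriorAlgebra ℝ (E x) := fun s => ExteriorAlgebra.ι ℝ (s x)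
  e (A.bracket v v') * e w * e w' - e (A.bracket v w') * e w * e v'
    - e (A.bracket w v') * e v * e w' + e (A.bracket w w') * e v * e v'

/-- `P` is an `A`-Poisson structure: `[P, P]_A = 0`. Near each point `x₀` the bivector `P` is a
finite sum `∑ v_i ∧ w_i`, and then `[P, P]_A (x₀) = ∑ [v_i ∧ w_i, v_j ∧ w_j]_A (x₀)`, which
does not depend on the choice of such a presentation. -/
def LieAlgebroid.IsPoisson (A : LieAlgebroid d X F E) (P : Bivector d F E) : Prop :=
  ∀ (x₀ : X) (k : ℕ) (v w : Fin k → Sec d F E),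
    (∀ᶠ x in 𝓝 x₀, (P.toFun x : ExteriorAlgebra ℝ (E x)) =
      ∑ i, ExteriorAlgebra.ι ℝ (v i x) * ExteriorAlgebra.ι ℝ (w i x)) →
    ∑ i, ∑ j, A.schouten (v i) (w i) (v j) (w j) x₀ = 0

variable (d X) in
/-- Bivector fields on `X`. -/
abbrev BivectorField : Type _ :=
  Bivector d (EuclideanSpace ℝ (Fin d)) (TangentSpace (𝓡 d) : X → Type _)

/-- The `A`-bivector `PA` is an `A`-lift of the bivector field `P`: `(⋀² ρ_A)(PA) = P`. -/
def LieAlgebroid.IsLift (A : LieAlgebroid d X F E) (PA : Bivector d F E)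
    (P : BivectorField d X) : Prop :=
  ∀ x, exteriorPower.map 2 (A.anchor x) (PA.toFun x) = P.toFun x

end Algebroid

section TopDegree

variable {n : ℕ} {X : Type*} [TopologicalSpace X]
  [ChartedSpace (EuclideanSpace ℝ (Fin (2 * n))) X] [IsManifold (𝓡 (2 * n)) ∞ X]

/-- The ideal `I_P` of a bivector field on a `2n`-dimensional manifold: the image of the evaluation
of the section `P^n` of `det(TX) = ⋀^{2n} TX` on the `2n`-forms. -/
def Bivector.ideal (P : BivectorField (2 * n) X) : Ideal (SmoothFun (2 * n) X) where
  carrier := {f | ∃ η : ∀ x : X, (TangentSpace (𝓡 (2 * n)) x) [⋀^Fin (2 * n)]→ₗ[ℝ] ℝ,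
    IsSmoothForm η ∧
    ∀ x, f x = exteriorPower.alternatingMapLinearEquiv (η x) (P.pfaffian n x)}
  add_mem' := by
    rintro f g ⟨η, hη, hf⟩ ⟨θ, hθ, hg⟩
    exact ⟨fun x => η x + θ x, fun v => (hη v).add (hθ v), fun x => by
      rw [map_add, LinearMap.add_apply, ← hf, ← hg]; rfl⟩
  zero_mem' := ⟨fun _ => 0, fun _ => contMDiff_const, fun x => by
    rw [map_zero]; rfl⟩
  smul_mem' := by
    rintro c f ⟨η, hη, hf⟩
    exact ⟨fun x => c x • η x, fun v => c.contMDiff.mul (hη v), fun x => by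
      rw [map_smul, LinearMap.smul_apply, ← hf]; rfl⟩

/-- A bivector field on a `2n`-dimensional manifold is of `I`-divisor-type: the pair
`(det(TX), P^n)` is a divisor, i.e. `P^n` has nowhere dense zero set, and its ideal is `I`. -/
def Bivector.IsOfDivisorType (P : BivectorField (2 * n) X) (I : Ideal (SmoothFun (2 * n) X)) :
    Prop :=
  IsNowhereDense {x : X | P.pfaffian n x = 0} ∧ Bivector.ideal P = I

end TopDegree

end DivType

end

/-! Let `G` be the coefficient of `P^n` in local coordinates `x_l`; it generates the ideal `I`
locally, and its nonvanishing locus `D` is dense. A vector field preserves `I` near a point exactly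
when it maps `G` to a multiple of `G`, and such fields, cut off by bump functions, are anchors of
sections of `A`.

The fields `G ∂_l` are of this kind. Where `G ≠ 0` they span the tangent space, so the anchor is
onto there, and injectivity on sections then becomes injectivity on the fibre
(`Bivector.anchor_bijective`). Hence a lift of `P` exists and is unique over `D`. It remains to see
that it extends smoothly.

Hamiltonian fields preserve `I`: by the Jacobi identity the matrix `p = ({x_i, x_j})` changes along
`X_f` by `N p + p Nᵀ`, with `N` the Jacobian of `X_f`, so its Pfaffian changes by the factor `tr N`
(`Bivector.exists_divergence`). In particular `{x_l, G} = h_l G`, so `W = P^♯(dG) / G` is smooth,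
and `W` kills `G` because `P` is skew.

Now let `α_i` be a local frame of `A^*`, and over `D` put `β_i = α_i ∘ ρ⁻¹` and `Y_i = P^♯ β_i`.
Moving `P^♯` across the pairing gives `dx_l(Y_i) = -α_i(X̃_l)` and `dG(Y_i) = -G α_i(W̃)`, where
`X̃_l` and `W̃` are the lifts of `X_{x_l}` and `W`. So `Y_i` extends smoothly, preserves `I`, and
lifts to `Ỹ_i`; the bivector `½ ∑ s_i ∧ Ỹ_i` is the lift (`Bivector.exists_local_lift`). Local lifts
glue by uniqueness, and `[P̃, P̃] = 0` follows by density from the same identity over `D`.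

For nondegeneracy, `P^n = det ρ · P̃^n`. If `P̃^n` has no zeros, `P^n` and `det ρ` differ by a unit,
so their ideals agree; as `divisorIdeal` is an algebraic span, this needs finitely many global
sections spanning every fibre (`exists_generators`). Conversely, if `det ρ = k G` locally, then `G =
k q G` with `q` the coefficient of `P̃^n`, and `k q = 1` by density. -/

noncomputable section

set_option linter.unusedSectionVars false

namespace DivType

/-! ### Contractions in the exterior algebra -/

section Exterior

variable {V W : Type*} [AddCommGroup V] [Module ℝ V] [AddCommGroup W] [Module ℝ W]

open ExteriorAlgebra in
/-- The interior product by a covector, as an endomorphism of the exterior algebra. -/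
def contract (α : Module.Dual ℝ V) : ExteriorAlgebra ℝ V →ₗ[ℝ] ExteriorAlgebra ℝ V :=
  CliffordAlgebra.contractLeft (Q := (0 : QuadraticForm ℝ V)) α

open ExteriorAlgebra

lemma contract_ι_mul (α : Module.Dual ℝ V) (v : V) (x : ExteriorAlgebra ℝ V) :
    contract α (ι ℝ v * x) = α v • x - ι ℝ v * contract α x :=
  CliffordAlgebra.contractLeft_ι_mul α v x

lemma contract_ι (α : Module.Dual ℝ V) (v : V) :
    contract α (ι ℝ v) = algebraMap ℝ _ (α v) :=
  CliffordAlgebra.contractLeft_ι _ α v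

lemma contract_one (α : Module.Dual ℝ V) : contract α 1 = 0 :=
  CliffordAlgebra.contractLeft_one _ α

lemma contract_algebraMap (α : Module.Dual ℝ V) (r : ℝ) :
    contract α (algebraMap ℝ _ r) = 0 :=
  CliffordAlgebra.contractLeft_algebraMap _ α r

lemma contract_ι_mul_ι (α : Module.Dual ℝ V) (v w : V) :
    contract α (ι ℝ v * ι ℝ w) = ι ℝ (α v • w - α w • v) := by
  rw [contract_ι_mul, contract_ι, ← Algebra.commutes, ← Algebra.smul_def, map_sub, map_smul,
    map_smul]

lemma contract_ι_mul_ι_mul_ι (α β γ : Module.Dual ℝ V) (a b c : V) :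
    contract γ (contract β (contract α (ι ℝ a * ι ℝ b * ι ℝ c))) = algebraMap ℝ _
      (α a * (β b * γ c - β c * γ b) - α b * (β a * γ c - β c * γ a)
        + α c * (β a * γ b - β b * γ a)) := by
  rw [mul_assoc, contract_ι_mul, contract_ι_mul_ι, map_sub, map_smul, contract_ι_mul_ι,
    contract_ι_mul]
  simp only [map_sub, map_smul, contract_ι, Algebra.algebraMap_eq_smul_one,
    mul_smul_comm, mul_sub, mul_one]
  module

lemma mem_extPower_succ {k : ℕ} {x : ExteriorAlgebra ℝ V} (v : V) (hx : x ∈ ⋀[ℝ]^k V) :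
    ι ℝ v * x ∈ ⋀[ℝ]^(k + 1) V := by
  rw [exteriorPower, pow_succ']
  exact Submodule.mul_mem_mul ⟨v, rfl⟩ hx

lemma extPower_induction {p : ℕ → ExteriorAlgebra ℝ V → Prop}
    (algebraMap : ∀ r : ℝ, p 0 (algebraMap ℝ _ r))
    (add : ∀ k x y, p k x → p k y → p k (x + y))
    (ι_mul : ∀ (k : ℕ) (v : V) (x), x ∈ ⋀[ℝ]^k V → p k x → p (k + 1) (ι ℝ v * x))
    {k : ℕ} {x : ExteriorAlgebra ℝ V} (hx : x ∈ ⋀[ℝ]^k V) : p k x := by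
  induction k generalizing x with
  | zero =>
    rw [exteriorPower, pow_zero, Submodule.mem_one] at hx
    obtain ⟨r, rfl⟩ := hx
    exact algebraMap r
  | succ k ih =>
    rw [exteriorPower, pow_succ'] at hx
    induction hx using Submodule.mul_induction_on' with
    | mem_mul_mem v hv y hy =>
      obtain ⟨v, rfl⟩ := hv
      exact ι_mul k v y hy (ih hy)
    | add a _ b _ ha hb => exact add _ _ _ ha hb

lemma ι_mul_ι_mem (v w : V) : ι ℝ v * ι ℝ w ∈ ⋀[ℝ]^2 V := by
  rw [exteriorPower, pow_two]
  exact Submodule.mul_mem_mul ⟨v, rfl⟩ ⟨w, rfl⟩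

lemma bivector_induction {p : ∀ x : ExteriorAlgebra ℝ V, x ∈ ⋀[ℝ]^2 V → Prop}
    (add : ∀ x hx y hy, p x hx → p y hy → p (x + y) (add_mem hx hy))
    (ι_mul_ι : ∀ v w : V, p (ι ℝ v * ι ℝ w) (ι_mul_ι_mem v w))
    {u : ExteriorAlgebra ℝ V} (hu : u ∈ ⋀[ℝ]^2 V) : p u hu := by
  have hu' := hu
  rw [exteriorPower, pow_two] at hu'
  have : ∃ h : u ∈ ⋀[ℝ]^2 V, p u h := by
    induction hu' using Submodule.mul_induction_on' with
    | mem_mul_mem v hv y hy =>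
      obtain ⟨v, rfl⟩ := hv
      obtain ⟨w, rfl⟩ := hy
      exact ⟨_, ι_mul_ι v w⟩
    | add a ha b hb iha ihb =>
      obtain ⟨ha', ha''⟩ := iha (by rwa [exteriorPower, pow_two])
      obtain ⟨hb', hb''⟩ := ihb (by rwa [exteriorPower, pow_two])
      exact ⟨_, add _ _ _ _ ha'' hb''⟩
  exact this.2

lemma bivector_pow_mem {u : ExteriorAlgebra ℝ V} (hu : u ∈ ⋀[ℝ]^2 V) (n : ℕ) :
    u ^ n ∈ ⋀[ℝ]^(2 * n) V := by
  rw [exteriorPower, pow_mul]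
  exact Submodule.pow_mem_pow _ hu n

lemma ι_mul_ι_swap (v w : V) : ι ℝ v * ι ℝ w = -(ι ℝ w * ι ℝ v) :=
  eq_neg_of_add_eq_zero_left (ι_add_mul_swap v w)

lemma contract_map (f : V →ₗ[ℝ] W) (α : Module.Dual ℝ W) (x : ExteriorAlgebra ℝ V) :
    contract α (map f x) = map f (contract (α ∘ₗ f) x) := by
  induction x using CliffordAlgebra.left_induction with
  | algebraMap r =>
    erw [AlgHom.commutes, contract_algebraMap, contract_algebraMap]
    simp
  | add x y hx hy => simp only [map_add, hx, hy]
  | ι_mul x v hx =>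
    change contract α (map f (ι ℝ v * x)) = map f (contract _ (ι ℝ v * x))
    rw [map_mul, map_apply_ι, contract_ι_mul, contract_ι_mul, hx, map_sub, map_smul, map_mul,
      map_apply_ι]
    rfl

lemma commute_ι_bivector {u : ExteriorAlgebra ℝ V} (hu : u ∈ ⋀[ℝ]^2 V) (v : V) :
    Commute (ι ℝ v) u := by
  induction hu using bivector_induction with
  | add x _ y _ hx hy => exact hx.add_right hy
  | ι_mul_ι a b =>
    change ι ℝ v * (ι ℝ a * ι ℝ b) = ι ℝ a * ι ℝ b * ι ℝ v
    rw [← mul_assoc, ι_mul_ι_swap v a, neg_mul, mul_assoc, ι_mul_ι_swap v b, mul_neg, neg_neg,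
      mul_assoc]

lemma commute_bivector {u w : ExteriorAlgebra ℝ V} (hu : u ∈ ⋀[ℝ]^2 V) (hw : w ∈ ⋀[ℝ]^2 V) :
    Commute w u := by
  induction hw using bivector_induction with
  | add x _ y _ hx hy => exact hx.add_left hy
  | ι_mul_ι a b => exact (commute_ι_bivector hu a).mul_left (commute_ι_bivector hu b)

/-- Contraction is an antiderivation; the sign disappears because `u` is even. -/
lemma contract_bivector_mul {u : ExteriorAlgebra ℝ V} (hu : u ∈ ⋀[ℝ]^2 V) (α : Module.Dual ℝ V)
    (x : ExteriorAlgebra ℝ V) :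
    contract α (u * x) = contract α u * x + u * contract α x := by
  induction hu using bivector_induction with
  | add a _ b _ ha hb => rw [add_mul, map_add, ha, hb, map_add]; noncomm_ring
  | ι_mul_ι a b =>
    rw [mul_assoc, contract_ι_mul, contract_ι_mul, contract_ι_mul_ι, mul_sub, map_sub, map_smul,
      map_smul, sub_mul, smul_mul_assoc, smul_mul_assoc, mul_smul_comm, mul_assoc]
    abel

/-- The map `V^* → V` given by a bivector. -/
def sharpAt (u : ExteriorAlgebra ℝ V) : Module.Dual ℝ V →ₗ[ℝ] V :=
  ιInv ∘ₗ LinearMap.flip (CliffordAlgebra.contractLeft (Q := (0 : QuadraticForm ℝ V))) u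

lemma sharpAt_apply (u : ExteriorAlgebra ℝ V) (α : Module.Dual ℝ V) :
    sharpAt u α = ιInv (contract α u) := rfl

lemma sharpAt_ι_mul_ι (v w : V) (α : Module.Dual ℝ V) :
    sharpAt (ι ℝ v * ι ℝ w) α = α v • w - α w • v := by
  rw [sharpAt_apply, contract_ι_mul_ι, ι_leftInverse]

lemma sharpAt_add (u u' : ExteriorAlgebra ℝ V) (α : Module.Dual ℝ V) :
    sharpAt (u + u') α = sharpAt u α + sharpAt u' α := by
  simp only [sharpAt_apply, map_add]

lemma sharpAt_sum {κ : Type*} (s : Finset κ) (u : κ → ExteriorAlgebra ℝ V) (α : Module.Dual ℝ V) :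
    sharpAt (∑ i ∈ s, u i) α = ∑ i ∈ s, sharpAt (u i) α := by
  simp only [sharpAt_apply, map_sum]

lemma ι_sharpAt {u : ExteriorAlgebra ℝ V} (hu : u ∈ ⋀[ℝ]^2 V) (α : Module.Dual ℝ V) :
    ι ℝ (sharpAt u α) = contract α u := by
  induction hu using bivector_induction with
  | add a _ b _ ha hb => rw [sharpAt_add, map_add, ha, hb, map_add]
  | ι_mul_ι a b => rw [sharpAt_ι_mul_ι, contract_ι_mul_ι]

lemma sharpAt_antisymm {u : ExteriorAlgebra ℝ V} (hu : u ∈ ⋀[ℝ]^2 V) (α β : Module.Dual ℝ V) :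
    β (sharpAt u α) = -α (sharpAt u β) := by
  induction hu using bivector_induction with
  | add a _ b _ ha hb => rw [sharpAt_add, sharpAt_add, map_add, map_add, ha, hb]; ring
  | ι_mul_ι a b =>
    simp only [sharpAt_ι_mul_ι, map_sub, map_smul, smul_eq_mul]
    ring

lemma map_mem_extPower (f : V →ₗ[ℝ] W) {k : ℕ} {x : ExteriorAlgebra ℝ V} (hx : x ∈ ⋀[ℝ]^k V) :
    map f x ∈ ⋀[ℝ]^k W := by
  refine extPower_induction (p := fun k x => map f x ∈ ⋀[ℝ]^k W) (fun r => ?_)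
    (fun k x y hx hy => ?_) (fun k v x _ hx => ?_) hx
  · rw [AlgHom.commutes, exteriorPower, pow_zero]
    exact Submodule.algebraMap_mem r
  · rw [map_add]
    exact add_mem hx hy
  · rw [map_mul, map_apply_ι]
    exact mem_extPower_succ _ hx

lemma sharpAt_map (f : V →ₗ[ℝ] W) {u : ExteriorAlgebra ℝ V} (hu : u ∈ ⋀[ℝ]^2 V)
    (α : Module.Dual ℝ W) : sharpAt (map f u) α = f (sharpAt u (α ∘ₗ f)) := by
  rw [sharpAt_apply, contract_map, ← ι_sharpAt hu, map_apply_ι, ι_leftInverse]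

lemma contract_pow_succ {u : ExteriorAlgebra ℝ V} (hu : u ∈ ⋀[ℝ]^2 V) (α : Module.Dual ℝ V)
    (n : ℕ) : contract α (u ^ (n + 1)) = ((n : ℝ) + 1) • (ι ℝ (sharpAt u α) * u ^ n) := by
  induction n with
  | zero => simp [ι_sharpAt hu]
  | succ n ih =>
    rw [pow_succ', contract_bivector_mul hu, ih, ← ι_sharpAt hu, mul_smul_comm, ← mul_assoc,
      ← (commute_ι_bivector hu _).eq, mul_assoc, ← pow_succ']
    push_cast
    module

variable {κ : Type*} [Fintype κ] (b : Module.Basis κ ℝ V)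

/-- Euler's identity: the left side is the derivation extending the identity of `V`, which
multiplies by the degree. It lets an element of positive degree be recovered from its contractions.
-/
lemma sum_ι_mul_contract {k : ℕ} {x : ExteriorAlgebra ℝ V} (hx : x ∈ ⋀[ℝ]^k V) :
    ∑ i, ι ℝ (b i) * contract (b.coord i) x = (k : ℝ) • x := by
  refine extPower_induction (p := fun k x => ∑ i, ι ℝ (b i) * contract (b.coord i) x = (k : ℝ) • x)
    (fun r => ?_) (fun k x y hx hy => ?_) (fun k v x _ hx => ?_) hx
  · simp [contract_algebraMap]
  · simp only [map_add, mul_add, Finset.sum_add_distrib, hx, hy, smul_add]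
  · have h1 : ∑ i, ι ℝ (b i) * (b.coord i v • x) = ι ℝ v * x := by
      simp only [mul_smul_comm, ← smul_mul_assoc, ← map_smul, ← Finset.sum_mul, ← map_sum]
      simp only [Module.Basis.coord_apply, b.sum_repr]
    have h2 : ∑ i, ι ℝ (b i) * (ι ℝ v * contract (b.coord i) x) = -((k : ℝ) • (ι ℝ v * x)) := by
      simp only [← mul_assoc, ι_mul_ι_swap _ v, neg_mul]
      rw [Finset.sum_neg_distrib]
      simp only [mul_assoc, ← Finset.mul_sum, hx, mul_smul_comm]
    simp only [contract_ι_mul, mul_sub, Finset.sum_sub_distrib, h1, h2]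
    push_cast
    module

include b in
lemma eq_zero_of_contract_eq_zero {k : ℕ} (hk : k ≠ 0) {x : ExteriorAlgebra ℝ V}
    (hx : x ∈ ⋀[ℝ]^k V) (h : ∀ α : Module.Dual ℝ V, contract α x = 0) : x = 0 := by
  have := sum_ι_mul_contract b hx
  simp only [h, mul_zero, Finset.sum_const_zero] at this
  have hk' : (k : ℝ) ≠ 0 := by exact_mod_cast hk
  exact (smul_eq_zero.1 this.symm).resolve_left hk'

lemma bivector_eq_sum {u : ExteriorAlgebra ℝ V} (hu : u ∈ ⋀[ℝ]^2 V) :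
    u = ∑ i, ι ℝ ((1 / 2 : ℝ) • b i) * ι ℝ (sharpAt u (b.coord i)) := by
  have := sum_ι_mul_contract b hu
  simp only [ι_sharpAt hu, map_smul, smul_mul_assoc, ← Finset.smul_sum, this]
  rw [smul_smul]
  norm_num

/-! ### Nondegeneracy and top powers of bivectors. -/

section FiniteDim

variable [FiniteDimensional ℝ V]

lemma extPower_eq_zero {k : ℕ} (hk : Module.finrank ℝ V < k) {x : ExteriorAlgebra ℝ V}
    (hx : x ∈ ⋀[ℝ]^k V) : x = 0 := by
  have h : Module.finrank ℝ (⋀[ℝ]^k V) = 0 := by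
    rw [exteriorPower.finrank_eq, Nat.choose_eq_zero_of_lt hk]
  have := Module.finrank_zero_iff.1 h
  exact congrArg Subtype.val (Subsingleton.elim (⟨x, hx⟩ : ⋀[ℝ]^k V) 0)

/-- Since `v ∧ x` lies above the top degree, contracting it gives `0 = α(v) x - v ∧ ι_α x`. -/
lemma eq_zero_of_contract_top {x : ExteriorAlgebra ℝ V} (hx : x ∈ ⋀[ℝ]^(Module.finrank ℝ V) V)
    (hx0 : x ≠ 0) {α : Module.Dual ℝ V} (h : contract α x = 0) : α = 0 := by
  ext v
  have h1 := contract_ι_mul α v x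
  rw [extPower_eq_zero (Nat.lt_succ_self _) (mem_extPower_succ v hx), h, map_zero, mul_zero,
    sub_zero] at h1
  exact (smul_eq_zero.1 h1.symm).resolve_right hx0

/-- A bivector with nonzero top power is nondegenerate. -/
lemma sharpAt_bijective {n : ℕ} (hn : Module.finrank ℝ V = 2 * n) {u : ExteriorAlgebra ℝ V}
    (hu : u ∈ ⋀[ℝ]^2 V) (h : u ^ n ≠ 0) : Function.Bijective (sharpAt u) := by
  have hinj : Function.Injective (sharpAt u) := by
    rw [injective_iff_map_eq_zero]
    intro α hα
    refine eq_zero_of_contract_top (x := u ^ n) (hn ▸ bivector_pow_mem hu n) h ?_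
    rcases n with _ | n
    · rw [pow_zero, contract_one]
    · rw [contract_pow_succ hu, hα, map_zero, zero_mul, smul_zero]
  refine ⟨hinj, ?_⟩
  exact (LinearMap.injective_iff_surjective_of_finrank_eq_finrank
    (Subspace.dual_finrank_eq)).1 hinj

/-- The powers of a nondegenerate bivector do not vanish. -/
lemma bivector_pow_ne_zero {n : ℕ} (hn : 2 * n ≤ Module.finrank ℝ V)
    {u : ExteriorAlgebra ℝ V} (hu : u ∈ ⋀[ℝ]^2 V) (h : Function.Surjective (sharpAt u)) :
    u ^ n ≠ 0 := by
  induction n with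
  | zero => simp
  | succ n ih =>
    intro h0
    -- Contracting `u^(n+1) = 0` with `α` gives `(n+1) u^♯(α) ∧ u^n = 0`, and every vector is some
    -- `u^♯(α)`.
    have hv (v : V) : ι ℝ v * u ^ n = 0 := by
      obtain ⟨α, rfl⟩ := h v
      have h1 := contract_pow_succ hu α n
      rw [h0, map_zero] at h1
      exact (smul_eq_zero.1 h1.symm).resolve_left (by positivity)
    let b := Module.finBasis ℝ V
    -- Euler's sum for `u^n` is `2n · u^n`; by `h2` each summand equals `u^n`, so it is also `dim V
    -- · u^n`. As `dim V ≥ 2n + 2`, this forces `u^n = 0`.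
    have h1 := sum_ι_mul_contract b (bivector_pow_mem hu n)
    have h2 (i) : ι ℝ (b i) * contract (b.coord i) (u ^ n) = u ^ n := by
      have := contract_ι_mul (b.coord i) (b i) (u ^ n)
      rw [hv, map_zero, Module.Basis.coord_apply, Module.Basis.repr_self,
        Finsupp.single_eq_same, one_smul] at this
      exact (sub_eq_zero.1 this.symm).symm
    simp only [h2, Finset.sum_const, Finset.card_univ, Fintype.card_fin] at h1
    rw [← Nat.cast_smul_eq_nsmul ℝ, ← sub_eq_zero, ← sub_smul] at h1
    refine ih (by omega) ((smul_eq_zero.1 h1).resolve_left ?_)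
    refine sub_ne_zero.2 ?_
    norm_cast
    omega

end FiniteDim

/-- The derivation of the exterior algebra extending an endomorphism. -/
def extDer (N : V →ₗ[ℝ] V) (x : ExteriorAlgebra ℝ V) : ExteriorAlgebra ℝ V :=
  ∑ i, ι ℝ (N (b i)) * contract (b.coord i) x

lemma extDer_ι_mul_ι (N : V →ₗ[ℝ] V) (v w : V) :
    extDer b N (ι ℝ v * ι ℝ w) = ι ℝ (N v) * ι ℝ w + ι ℝ v * ι ℝ (N w) := by
  have h1 (v w : V) : ∑ i, b.coord i v • (ι ℝ (N (b i)) * ι ℝ w) = ι ℝ (N v) * ι ℝ w := by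
    simp only [← smul_mul_assoc, ← map_smul, ← Finset.sum_mul, ← map_sum]
    simp only [Module.Basis.coord_apply, b.sum_repr]
  simp only [extDer, contract_ι_mul_ι, map_sub, map_smul, mul_sub, mul_smul_comm,
    Finset.sum_sub_distrib, h1]
  rw [ι_mul_ι_swap v, sub_eq_add_neg]

lemma extDer_sum (N : V →ₗ[ℝ] V) {κ' : Type*} (s : Finset κ') (u : κ' → ExteriorAlgebra ℝ V) :
    extDer b N (∑ j ∈ s, u j) = ∑ j ∈ s, extDer b N (u j) := by
  simp only [extDer, map_sum, Finset.mul_sum]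
  exact Finset.sum_comm

lemma extDer_smul (N : V →ₗ[ℝ] V) (c : ℝ) (u : ExteriorAlgebra ℝ V) :
    extDer b N (c • u) = c • extDer b N u := by
  simp only [extDer, map_smul, mul_smul_comm, Finset.smul_sum]

lemma extDer_bivector_mul (N : V →ₗ[ℝ] V) {u : ExteriorAlgebra ℝ V} (hu : u ∈ ⋀[ℝ]^2 V)
    (x : ExteriorAlgebra ℝ V) : extDer b N (u * x) = extDer b N u * x + u * extDer b N x := by
  simp only [extDer, contract_bivector_mul hu, mul_add, Finset.sum_add_distrib, Finset.sum_mul,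
    Finset.mul_sum, mul_assoc]
  congr 1
  refine Finset.sum_congr rfl fun i _ => ?_
  rw [← mul_assoc, (commute_ι_bivector hu _).eq, mul_assoc]

lemma extDer_mem (N : V →ₗ[ℝ] V) {u : ExteriorAlgebra ℝ V} (hu : u ∈ ⋀[ℝ]^2 V) :
    extDer b N u ∈ ⋀[ℝ]^2 V := by
  refine Submodule.sum_mem _ fun i _ => ?_
  rw [← ι_sharpAt hu]
  exact ι_mul_ι_mem _ _

lemma extDer_pow_succ (N : V →ₗ[ℝ] V) {u : ExteriorAlgebra ℝ V} (hu : u ∈ ⋀[ℝ]^2 V) (n : ℕ) :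
    extDer b N (u ^ (n + 1)) = ((n : ℝ) + 1) • (extDer b N u * u ^ n) := by
  induction n with
  | zero => simp
  | succ n ih =>
    rw [pow_succ', extDer_bivector_mul b N hu, ih, mul_smul_comm, ← mul_assoc,
      ← (commute_bivector hu (extDer_mem b N hu)).eq, mul_assoc, ← pow_succ']
    push_cast
    module

/-- A derivation acts on top degree by the trace: `N b_i ∧ x` vanishes for degree reasons, and
contracting it with the dual covector isolates the `i`-th diagonal entry. -/
lemma extDer_top [FiniteDimensional ℝ V] (N : V →ₗ[ℝ] V) {x : ExteriorAlgebra ℝ V}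
    (hx : x ∈ ⋀[ℝ]^(Module.finrank ℝ V) V) :
    extDer b N x = (∑ i, b.coord i (N (b i))) • x := by
  rw [Finset.sum_smul]
  refine Finset.sum_congr rfl fun i _ => ?_
  have := contract_ι_mul (b.coord i) (N (b i)) x
  rw [extPower_eq_zero (Nat.lt_succ_self _) (mem_extPower_succ _ hx), map_zero] at this
  exact (sub_eq_zero.1 this.symm).symm

/-- The linear functional on the exterior algebra given by an alternating form of degree `k`. -/
def formFunctional {k : ℕ} (η : V [⋀^Fin k]→ₗ[ℝ] ℝ) : ExteriorAlgebra ℝ V →ₗ[ℝ] ℝ :=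
  liftAlternating (Function.update 0 k η)

lemma formFunctional_ιMulti {k : ℕ} (η : V [⋀^Fin k]→ₗ[ℝ] ℝ) (v : Fin k → V) :
    formFunctional η (ιMulti ℝ k v) = η v := by
  rw [formFunctional, liftAlternating_apply_ιMulti, Function.update_self]

/-- Pairings are moved from the exterior power to the whole exterior algebra, where `P^n` is an
honest product. -/
lemma alternatingMapLinearEquiv_eq {k : ℕ} (η : V [⋀^Fin k]→ₗ[ℝ] ℝ) (x : ⋀[ℝ]^k V) :
    exteriorPower.alternatingMapLinearEquiv η x = formFunctional η (x : ExteriorAlgebra ℝ V) := by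
  have : exteriorPower.alternatingMapLinearEquiv η
      = formFunctional η ∘ₗ (⋀[ℝ]^k V).subtype := by
    apply exteriorPower.linearMap_ext
    ext v
    simp [formFunctional_ιMulti]
  rw [this]
  rfl

lemma formFunctional_map {k : ℕ} (f : V →ₗ[ℝ] W) (η : W [⋀^Fin k]→ₗ[ℝ] ℝ)
    {x : ExteriorAlgebra ℝ V} (hx : x ∈ ⋀[ℝ]^k V) :
    formFunctional η (map f x) = formFunctional (η.compLinearMap f) x := by
  have : (formFunctional η ∘ₗ (ExteriorAlgebra.map f).toLinearMap) ∘ₗ (⋀[ℝ]^k V).subtype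
      = formFunctional (η.compLinearMap f) ∘ₗ (⋀[ℝ]^k V).subtype := by
    apply exteriorPower.linearMap_ext
    ext v
    simp [formFunctional_ιMulti]
    rfl
  exact LinearMap.congr_fun this ⟨x, hx⟩

lemma exteriorPower_map_coe {k : ℕ} (f : V →ₗ[ℝ] W) (x : ⋀[ℝ]^k V) :
    (exteriorPower.map k f x : ExteriorAlgebra ℝ W) = map f (x : ExteriorAlgebra ℝ V) := by
  have : (⋀[ℝ]^k W).subtype ∘ₗ exteriorPower.map k f
      = (ExteriorAlgebra.map f).toLinearMap ∘ₗ (⋀[ℝ]^k V).subtype := by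
    apply exteriorPower.linearMap_ext
    ext v
    simp
  exact LinearMap.congr_fun this x

lemma formFunctional_smul {k : ℕ} (c : ℝ) (η : V [⋀^Fin k]→ₗ[ℝ] ℝ) (x : ExteriorAlgebra ℝ V)
    (hx : x ∈ ⋀[ℝ]^k V) : formFunctional (c • η) x = c * formFunctional η x := by
  have h1 := alternatingMapLinearEquiv_eq (c • η) ⟨x, hx⟩
  rw [map_smul, LinearMap.smul_apply, alternatingMapLinearEquiv_eq] at h1
  exact h1.symm

lemma eq_zero_of_formFunctional {k : ℕ} {x : ExteriorAlgebra ℝ V} (hx : x ∈ ⋀[ℝ]^k V)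
    (h : ∀ η : V [⋀^Fin k]→ₗ[ℝ] ℝ, formFunctional η x = 0) : x = 0 := by
  have : (⟨x, hx⟩ : ⋀[ℝ]^k V) = 0 := by
    rw [← Module.forall_dual_apply_eq_zero_iff ℝ]
    intro φ
    obtain ⟨η, rfl⟩ := exteriorPower.alternatingMapLinearEquiv.surjective φ
    rw [alternatingMapLinearEquiv_eq, h]
  exact congrArg Subtype.val this

end Exterior

/-! ### Smooth functions, covectors and frames -/

section Smooth

variable {d : ℕ} {X : Type*} [TopologicalSpace X] [ChartedSpace (EuclideanSpace ℝ (Fin d)) X]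
variable {F : Type*} [NormedAddCommGroup F] [NormedSpace ℝ F]
  {E : X → Type*} [TopologicalSpace (TotalSpace F E)] [∀ x, TopologicalSpace (E x)]
  [FiberBundle F E] [∀ x, AddCommGroup (E x)] [∀ x, Module ℝ (E x)]

variable (d F E) in
/-- Smooth sections of the dual bundle. -/
structure Covector where
  toFun : ∀ x, Module.Dual ℝ (E x)
  smooth : ∀ s : Sec d F E, ContMDiff (𝓡 d) 𝓘(ℝ, ℝ) ∞ fun x => toFun x (s x)

/-- The pairing of a covector with a section. -/
def Covector.pair (α : Covector d F E) (s : Sec d F E) : SmoothFun d X :=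
  ⟨fun x => α.toFun x (s x), α.smooth s⟩

@[simp] lemma Covector.pair_apply (α : Covector d F E) (s : Sec d F E) (x : X) :
    α.pair s x = α.toFun x (s x) := rfl

@[simp] lemma fsmul_apply [VectorBundle ℝ F E] (f : SmoothFun d X) (s : Sec d F E) (x : X) :
    fsmul f s x = f x • s x := rfl

/-- This justifies every division by the local generator of the ideal: an identity is checked where
the generator is nonzero and extended by continuity. -/
lemma eq_zero_of_dense {f : X → ℝ} {U D : Set X} (hf : ContinuousOn f U) (hU : IsOpen U)
    (hD : Dense D) (h : ∀ x ∈ U, x ∈ D → f x = 0) {x : X} (hx : x ∈ U) : f x = 0 := by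
  have h1 : x ∈ closure (U ∩ D) := hD.open_subset_closure_inter hU hx
  by_contra hne
  have h2 : f ⁻¹' {0}ᶜ ∩ U ∈ 𝓝 x := by
    have := (hf.continuousAt (hU.mem_nhds hx)).preimage_mem_nhds
      (isOpen_compl_singleton.mem_nhds (show f x ∈ ({0}ᶜ : Set ℝ) from hne))
    exact inter_mem this (hU.mem_nhds hx)
  obtain ⟨y, hy1, hy2⟩ := mem_closure_iff_nhds.1 h1 _ h2
  exact hy1.1 (h y hy2.1 hy2.2)

variable [IsManifold (𝓡 d) ∞ X]

lemma smooth_dir (V : VF d X) (f : SmoothFun d X) :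
    ContMDiff (𝓡 d) 𝓘(ℝ, ℝ) ∞ fun x => mvfderiv (𝓡 d) f x (V x) := by
  have h1 := (f.contMDiff.contMDiff_tangentMap (m := ∞) (by simp)).comp V.contMDiff
  exact (contMDiff_snd_tangentBundle_modelSpace ℝ 𝓘(ℝ, ℝ)).comp h1

/-- The differential of a smooth function. -/
def dcov (f : SmoothFun d X) :
    Covector d (EuclideanSpace ℝ (Fin d)) (TangentSpace (𝓡 d) : X → Type _) :=
  ⟨fun x => (mvfderiv (𝓡 d) f x).toLinearMap, fun V => smooth_dir V f⟩

lemma dcov_apply (f : SmoothFun d X) (x : X) (v : TangentSpace (𝓡 d) x) :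
    (dcov f).toFun x v = mvfderiv (𝓡 d) f x v := rfl

omit [IsManifold (𝓡 d) ∞ X] in
lemma SmoothFun.mdiff (f : SmoothFun d X) (x : X) : MDifferentiableAt (𝓡 d) 𝓘(ℝ, ℝ) f x :=
  f.contMDiff.mdifferentiableAt (by simp)

lemma dcov_mul (f g : SmoothFun d X) (x : X) :
    (dcov (f * g)).toFun x = f x • (dcov g).toFun x + g x • (dcov f).toFun x := by
  ext v
  have := mvfderiv_mul (f.mdiff x) (g.mdiff x)
  simp only [dcov_apply, LinearMap.add_apply, LinearMap.smul_apply]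
  change mvfderiv (𝓡 d) (⇑f * ⇑g) x v = _
  rw [this]
  rfl

lemma dcov_add (f g : SmoothFun d X) (x : X) :
    (dcov (f + g)).toFun x = (dcov f).toFun x + (dcov g).toFun x := by
  ext v
  have := mvfderiv_add (f.mdiff x) (g.mdiff x)
  simp only [dcov_apply, LinearMap.add_apply]
  change mvfderiv (𝓡 d) (⇑f + ⇑g) x v = _
  rw [this]
  rfl

lemma dcov_congr {f g : SmoothFun d X} {x : X} (h : ∀ᶠ y in 𝓝 x, f y = g y) :
    (dcov f).toFun x = (dcov g).toFun x := by
  ext v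
  have : mfderiv (𝓡 d) 𝓘(ℝ, ℝ) f x = mfderiv (𝓡 d) 𝓘(ℝ, ℝ) g x := Filter.EventuallyEq.mfderiv_eq h
  change (mfderiv (𝓡 d) 𝓘(ℝ, ℝ) f x) v = (mfderiv (𝓡 d) 𝓘(ℝ, ℝ) g x) v
  rw [this]
  rfl

lemma dcov_const (c : ℝ) (x : X) :
    (dcov (⟨fun _ => c, contMDiff_const⟩ : SmoothFun d X)).toFun x = 0 := by
  ext v
  change mvfderiv (𝓡 d) (fun _ => c) x v = 0
  rw [mvfderiv_const]
  rfl

/-! ### Cutoffs and local frames extended to global sections. -/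

section Bump

variable [T2Space X]

lemma exists_bump {x₀ : X} {U : Set X} (hU : U ∈ 𝓝 x₀) :
    ∃ χ : SmoothFun d X, (∃ U', IsOpen U' ∧ x₀ ∈ U' ∧ U' ⊆ U ∧ ∀ y ∈ U', χ y = 1) ∧
      tsupport χ ⊆ U := by
  obtain ⟨f, hf, -⟩ := (SmoothBumpFunction.nhds_basis_support (I := 𝓡 d) hU).mem_iff.1 hU
  refine ⟨⟨f, f.contMDiff⟩, ?_, hf⟩
  have h1 := f.eventuallyEq_one
  obtain ⟨t, ht, hto, hxt⟩ := eventually_nhds_iff.1 (h1.and hU)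
  exact ⟨t, hto, hxt, fun y hy => (ht y hy).2, fun y hy => (ht y hy).1⟩

/-- The extension by zero of a product with a bump function. -/
def bumpSec [VectorBundle ℝ F E] (χ : SmoothFun d X) {U : Set X} (hU : IsOpen U)
    (hχ : tsupport χ ⊆ U) (s : ∀ x, E x)
    (hs : ContMDiffOn (𝓡 d) ((𝓡 d).prod 𝓘(ℝ, F)) ∞ (fun x => TotalSpace.mk' F x (s x)) U) :
    Sec d F E :=
  ⟨fun x => χ x • s x, ContMDiffOn.smul_section_of_tsupport χ.contMDiff.contMDiffOn hU hχ hs⟩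

/-- The extension by zero of a product with a bump function. -/
def bumpFun (χ : SmoothFun d X) {U : Set X} (hU : IsOpen U)
    (hχ : tsupport χ ⊆ U) (s : X → ℝ) (hs : ContMDiffOn (𝓡 d) 𝓘(ℝ, ℝ) ∞ s U) :
    SmoothFun d X :=
  ⟨fun x => χ x * s x, by
    refine contMDiff_of_tsupport fun x hx => ?_
    have hxU := hχ (tsupport_mul_subset_left hx)
    exact χ.contMDiff.contMDiffAt.mul (hs.contMDiffAt (hU.mem_nhds hxU))⟩

end Bump

/-- Sections and covectors that are dual bases of each fibre over an open set. -/
structure IsFrameOn {κ : Type*} [Fintype κ] [DecidableEq κ] (α : κ → Covector d F E)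
    (s : κ → Sec d F E) (U : Set X) : Prop where
  isOpen : IsOpen U
  expand : ∀ x ∈ U, ∀ v : E x, ∑ i, (α i).toFun x v • s i x = v
  dual : ∀ x ∈ U, ∀ i j, (α i).toFun x (s j x) = if i = j then 1 else 0

namespace IsFrameOn

variable {κ : Type*} [Fintype κ] [DecidableEq κ] {α : κ → Covector d F E}
    {s : κ → Sec d F E} {U : Set X}

omit [IsManifold (𝓡 d) ∞ X] in
lemma mono (h : IsFrameOn α s U) {U' : Set X} (hU' : IsOpen U') (hsub : U' ⊆ U) :
    IsFrameOn α s U' :=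
  ⟨hU', fun x hx => h.expand x (hsub hx), fun x hx => h.dual x (hsub hx)⟩

/-- The basis of a fibre given by a frame. -/
def basis (h : IsFrameOn α s U) {x : X} (hx : x ∈ U) : Module.Basis κ ℝ (E x) :=
  Module.Basis.ofEquivFun
    { toFun := fun v i => (α i).toFun x v
      map_add' := fun v w => by ext i; simp
      map_smul' := fun c v => by ext i; simp
      invFun := fun c => ∑ i, c i • s i x
      left_inv := fun v => h.expand x hx v
      right_inv := fun c => by
        ext i
        simp [h.dual x hx] }

omit [IsManifold (𝓡 d) ∞ X] in
@[simp] lemma basis_apply (h : IsFrameOn α s U) {x : X} (hx : x ∈ U) (i : κ) :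
    h.basis hx i = s i x := by
  simp [basis, Pi.single_apply]

omit [IsManifold (𝓡 d) ∞ X] in
@[simp] lemma basis_coord (h : IsFrameOn α s U) {x : X} (hx : x ∈ U) (i : κ) :
    (h.basis hx).coord i = (α i).toFun x := by
  ext v
  simp [basis]

omit [IsManifold (𝓡 d) ∞ X] in
lemma ext (h : IsFrameOn α s U) {x : X} (hx : x ∈ U) {v w : E x}
    (hvw : ∀ i, (α i).toFun x v = (α i).toFun x w) : v = w := by
  rw [← h.expand x hx v, ← h.expand x hx w]
  simp only [hvw]

end IsFrameOn

variable [T2Space X] [FiniteDimensional ℝ F] [VectorBundle ℝ F E] [ContMDiffVectorBundle ∞ F E (𝓡 d)]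

-- Local frames and coframes of the trivialization are multiplied by a bump function, so that all
-- frame arguments can use globally defined sections and covectors; duality holds where the bump
-- equals `1`.
variable (d F E) in
lemma exists_frame_of_trivialization {κ : Type*} [Fintype κ] [DecidableEq κ]
    (b : Module.Basis κ ℝ F) (x₀ : X) :
    ∃ (χ : SmoothFun d X) (α : κ → Covector d F E) (s : κ → Sec d F E) (U : Set X), x₀ ∈ U ∧
      IsFrameOn α s U ∧ U ⊆ (trivializationAt F E x₀).baseSet ∧ (∀ y ∈ U, χ y = 1) ∧
      tsupport χ ⊆ (trivializationAt F E x₀).baseSet ∧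
      ∀ y ∈ U, ∀ i v, (α i).toFun y v =
        b.repr ((trivializationAt F E x₀).continuousLinearMapAt ℝ y v) i := by
  set e := trivializationAt F E x₀ with he
  have hx₀ : x₀ ∈ e.baseSet := FiberBundle.mem_baseSet_trivializationAt' x₀
  have : ContMDiffVectorBundle 1 F E (𝓡 d) := ContMDiffVectorBundle.of_le (n := ∞) (by simp)
  obtain ⟨χ, ⟨U, hUo, hxU, hUs, hχ1⟩, hχs⟩ := exists_bump (d := d) (e.open_baseSet.mem_nhds hx₀)
  have hframe := e.isLocalFrameOn_localFrame_baseSet (𝓡 d) ∞ b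
  let s : κ → Sec d F E := fun i => bumpSec χ e.open_baseSet hχs (e.localFrame b i)
    (e.contMDiffOn_localFrame_baseSet ∞ b i)
  let α : κ → Covector d F E := fun i =>
    ⟨fun x => χ x • e.localFrameCoeff (𝓡 d) b i x, fun t =>
      (bumpFun χ e.open_baseSet hχs (fun x => e.localFrameCoeff (𝓡 d) b i x (t x))
        (contMDiffOn_localFrameCoeff b e.open_baseSet subset_rfl
          t.contMDiff.contMDiffOn i)).contMDiff⟩
  have hα (x) (hx : x ∈ U) (i v) : (α i).toFun x v = (e.basisAt b (hUs hx)).repr v i := by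
    classical
    -- The coefficient is evaluated on the rough section equal to `v` at `x` and zero elsewhere.
    have h1 := e.localFrameCoeff_apply_of_mem_baseSet (I := 𝓡 d) b (hUs hx)
      (fun y => if h : y = x then h ▸ v else 0) i
    simp only [dif_pos] at h1
    rw [← h1]
    change (χ x • e.localFrameCoeff (𝓡 d) b i x) v = _
    rw [hχ1 x hx, one_smul]
  have hs (x) (hx : x ∈ U) (i) : s i x = e.basisAt b (hUs hx) i := by
    change χ x • e.localFrame b i x = _
    rw [hχ1 x hx, one_smul, e.localFrame_apply_of_mem_baseSet b (hUs hx)]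
  refine ⟨χ, α, s, U, hxU, ⟨hUo, ?_, ?_⟩, hUs, hχ1, hχs, ?_⟩
  · intro x hx v
    simp only [hα x hx, hs x hx, Module.Basis.sum_repr]
  · intro x hx i j
    simp only [hα x hx, hs x hx, Module.Basis.repr_self, Finsupp.single_apply, eq_comm]
  · intro y hy i v
    rw [hα y hy, e.continuousLinearMapAt_apply_of_mem _ (hUs hy)]
    simp [Trivialization.basisAt]

variable (d F E) in
lemma exists_frame (x₀ : X) :
    ∃ (α : Fin (Module.finrank ℝ F) → Covector d F E) (s : Fin (Module.finrank ℝ F) → Sec d F E)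
      (U : Set X), x₀ ∈ U ∧ IsFrameOn α s U := by
  obtain ⟨-, α, s, U, hx, hU, -⟩ :=
    exists_frame_of_trivialization d F E (Module.finBasis ℝ F) x₀
  exact ⟨α, s, U, hx, hU⟩

variable (d) in
/-- Local coordinates, extended to global functions and global vector fields. -/
lemma exists_coordinates (x₀ : X) :
    ∃ (x : Fin d → SmoothFun d X) (D : Fin d → VF d X) (U : Set X), x₀ ∈ U ∧
      IsFrameOn (fun i => dcov (x i)) D U := by
  let b := (EuclideanSpace.basisFun (Fin d) ℝ).toBasis
  obtain ⟨χ, α, s, U, hx, hU, hUs, hχ, hχs, hα⟩ :=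
    exists_frame_of_trivialization d (EuclideanSpace ℝ (Fin d))
      (TangentSpace (𝓡 d) : X → Type _) b x₀
  have hbase : (trivializationAt (EuclideanSpace ℝ (Fin d)) (TangentSpace (𝓡 d) : X → Type _)
    x₀).baseSet = (chartAt (EuclideanSpace ℝ (Fin d)) x₀).source := rfl
  rw [hbase] at hUs hχs
  let x : Fin d → SmoothFun d X := fun i => bumpFun χ (chartAt _ x₀).open_source hχs
    (fun y => extChartAt (𝓡 d) x₀ y i) (by
      have h1 : ContMDiffOn (𝓡 d) 𝓘(ℝ, EuclideanSpace ℝ (Fin d)) ∞ (extChartAt (𝓡 d) x₀)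
        (chartAt (EuclideanSpace ℝ (Fin d)) x₀).source := contMDiffOn_extChartAt
      have h2 : ContMDiff 𝓘(ℝ, EuclideanSpace ℝ (Fin d)) 𝓘(ℝ, ℝ) ∞
        (fun z : EuclideanSpace ℝ (Fin d) => z i) :=
        (EuclideanSpace.proj i : EuclideanSpace ℝ (Fin d) →L[ℝ] ℝ).contDiff.contMDiff
      exact h2.comp_contMDiffOn h1)
  -- The trivialization of the tangent bundle is the derivative of the chart, so its dual frame
  -- consists of the differentials of the chart coordinates.
  have key : ∀ y ∈ U, ∀ i, (dcov (x i)).toFun y = (α i).toFun y := by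
    intro y hy i
    ext v
    rw [hα y hy, TangentBundle.continuousLinearMapAt_trivializationAt (hUs hy), dcov_apply]
    have h1 : mfderiv (𝓡 d) 𝓘(ℝ, ℝ) (x i) y =
        mfderiv (𝓡 d) 𝓘(ℝ, ℝ) ((EuclideanSpace.proj i : EuclideanSpace ℝ (Fin d) →L[ℝ] ℝ) ∘
          extChartAt (𝓡 d) x₀) y := by
      refine Filter.EventuallyEq.mfderiv_eq ?_
      filter_upwards [hU.isOpen.mem_nhds hy] with z hz
      change χ z * _ = _
      rw [hχ z hz, one_mul]
      rfl
    have h2 := mfderiv_comp_apply (I := 𝓡 d) (I' := 𝓘(ℝ, EuclideanSpace ℝ (Fin d)))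
      (I'' := 𝓘(ℝ, ℝ)) y
      (EuclideanSpace.proj i : EuclideanSpace ℝ (Fin d) →L[ℝ] ℝ).differentiableAt.mdifferentiableAt
      (mdifferentiableAt_extChartAt (I := 𝓡 d) (hUs hy)) v
    change mfderiv (𝓡 d) 𝓘(ℝ, ℝ) (x i) y v = _
    rw [h1]
    refine h2.trans ?_
    rw [mfderiv_eq_fderiv, ContinuousLinearMap.fderiv]
    simp [b]
    rfl
  refine ⟨x, s, U, hx, hU.isOpen, fun y hy v => ?_, fun y hy i j => ?_⟩
  · simp only [key y hy]
    exact hU.expand y hy v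
  · simp only [key y hy]
    exact hU.dual y hy i j

end Smooth

/-! ### Anchors, brackets and bivectors -/

section Algebroids

variable {d : ℕ} {X : Type*} [TopologicalSpace X] [ChartedSpace (EuclideanSpace ℝ (Fin d)) X]
  [IsManifold (𝓡 d) ∞ X]
variable {F : Type*} [NormedAddCommGroup F] [NormedSpace ℝ F]
  {E : X → Type*} [TopologicalSpace (TotalSpace F E)] [∀ x, TopologicalSpace (E x)]
  [FiberBundle F E] [∀ x, AddCommGroup (E x)] [∀ x, Module ℝ (E x)]

lemma dcov_neg (f : SmoothFun d X) (x : X) : (dcov (-f)).toFun x = -(dcov f).toFun x := by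
  have h := dcov_add f (-f) x
  rw [add_neg_cancel] at h
  have h0 : (dcov (0 : SmoothFun d X)).toFun x = 0 := dcov_const 0 x
  rw [h0] at h
  exact (neg_eq_of_add_eq_zero_right h.symm).symm

lemma dcov_sub (f g : SmoothFun d X) (x : X) :
    (dcov (f - g)).toFun x = (dcov f).toFun x - (dcov g).toFun x := by
  rw [sub_eq_add_neg, dcov_add, dcov_neg, sub_eq_add_neg]

lemma dcov_sum {κ : Type*} (s : Finset κ) (f : κ → SmoothFun d X) (x : X) :
    (dcov (∑ i ∈ s, f i)).toFun x = ∑ i ∈ s, (dcov (f i)).toFun x := by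
  classical
  induction s using Finset.induction_on with
  | empty => exact dcov_const 0 x
  | insert a s ha ih => rw [Finset.sum_insert ha, Finset.sum_insert ha, dcov_add, ih]

omit [IsManifold (𝓡 d) ∞ X] in
lemma SmoothFun.sum_apply {κ : Type*} (s : Finset κ) (f : κ → SmoothFun d X) (x : X) :
    (∑ i ∈ s, f i) x = ∑ i ∈ s, f i x :=
  map_sum (ContMDiffMap.evalRingHom (I := 𝓡 d) (n := ∞) x) f s

variable [VectorBundle ℝ F E]

omit [IsManifold (𝓡 d) ∞ X] in
lemma Sec.sum_apply {κ : Type*} (t : Finset κ) (s : κ → Sec d F E) (x : X) :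
    (∑ i ∈ t, s i) x = ∑ i ∈ t, s i x :=
  map_sum (⟨⟨fun s => s x, rfl⟩, fun _ _ => rfl⟩ : Sec d F E →+ E x) s t

variable [ContMDiffVectorBundle ∞ F E (𝓡 d)]

namespace LieAlgebroid

variable (A : LieAlgebroid d X F E)

/-- The vector field `ρ(s)`. -/
def anchorSec (s : Sec d F E) : VF d X :=
  ⟨fun x => A.anchor x (s x), A.anchor_smooth.comp s.contMDiff⟩

@[simp] lemma anchorSec_apply (s : Sec d F E) (x : X) : A.anchorSec s x = A.anchor x (s x) := rfl

lemma bracket_fsmul (f : SmoothFun d X) (v w : Sec d F E) :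
    A.bracket v (fsmul f w) =
      fsmul f (A.bracket v w) + fsmul ((dcov f).pair (A.anchorSec v)) w := by
  ext1 x
  exact A.leibniz f v w x

/-- The anchor preserves brackets. -/
lemma dcov_anchor_bracket (u v w : Sec d F E) (f : SmoothFun d X) {x : X} (hw : w x ≠ 0) :
    (dcov f).toFun x (A.anchor x (A.bracket u v x)) =
      (dcov ((dcov f).pair (A.anchorSec v))).toFun x (A.anchor x (u x)) -
      (dcov ((dcov f).pair (A.anchorSec u))).toFun x (A.anchor x (v x)) := by
  -- Expand the Jacobi identity for `u, v, f w` by Leibniz. After subtracting `f` times the identity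
  -- for `u, v, w`, the mixed terms cancel and only a multiple of `w x` is left; this is why a
  -- nonvanishing `w x` is required.
  have h := A.jacobi u v (fsmul f w)
  simp only [bracket_fsmul, A.bracket_add_right] at h
  have hx := congrArg (fun s : Sec d F E => s x) h
  have hj := congrArg (fun s : Sec d F E => s x) (A.jacobi u v w)
  simp only [ContMDiffSection.coe_add, Pi.add_apply, fsmul_apply, Covector.pair_apply,
    anchorSec_apply] at hx hj
  rw [hj] at hx
  set a := (dcov f).toFun x (A.anchor x (A.bracket u v x))
  set b := (dcov ((dcov f).pair (A.anchorSec v))).toFun x (A.anchor x (u x))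
  set c := (dcov ((dcov f).pair (A.anchorSec u))).toFun x (A.anchor x (v x))
  have h0 : (a - (b - c)) • w x = 0 := by
    rw [← sub_eq_zero] at hx
    rw [← neg_eq_zero, ← hx]
    module
  exact sub_eq_zero.1 ((smul_eq_zero.1 h0).resolve_right hw)

end LieAlgebroid

namespace Bivector

variable (P : Bivector d F E)

/-- The value of a bivector in the exterior algebra. -/
def val (x : X) : ExteriorAlgebra ℝ (E x) := (P.toFun x : ExteriorAlgebra ℝ (E x))

lemma val_mem (x : X) : P.val x ∈ ⋀[ℝ]^2 (E x) := (P.toFun x).2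

lemma ext_val {P Q : Bivector d F E} (h : ∀ x, P.val x = Q.val x) : P = Q := by
  ext x : 2
  exact Subtype.ext (h x)

lemma exists_presentation (x₀ : X) : ∃ (k : ℕ) (v w : Fin k → Sec d F E), ∀ᶠ x in 𝓝 x₀,
    P.val x = ∑ i, ExteriorAlgebra.ι ℝ (v i x) * ExteriorAlgebra.ι ℝ (w i x) := P.smooth x₀

lemma sharpAt_sum_ι_mul_ι {V : Type*} [AddCommGroup V] [Module ℝ V] {k : ℕ} (v w : Fin k → V)
    (α : Module.Dual ℝ V) :
    sharpAt (∑ i, ExteriorAlgebra.ι ℝ (v i) * ExteriorAlgebra.ι ℝ (w i)) α =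
      ∑ i, (α (v i) • w i - α (w i) • v i) := by
  rw [sharpAt_sum]
  exact Finset.sum_congr rfl fun i _ => sharpAt_ι_mul_ι _ _ _

/-- The section `P^♯ α`. -/
def sharpSec (α : Covector d F E) : Sec d F E :=
  ⟨fun x => sharpAt (P.val x) (α.toFun x), fun x₀ => by
    obtain ⟨k, v, w, h⟩ := P.exists_presentation x₀
    refine ((∑ i, (fsmul (α.pair (v i)) (w i) - fsmul (α.pair (w i)) (v i))).contMDiff
      x₀).congr_of_eventuallyEq ?_
    filter_upwards [h] with x hx
    rw [hx, sharpAt_sum_ι_mul_ι, Sec.sum_apply]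
    rfl⟩

/-- The function `P(α, β)`. -/
def contr (α β : Covector d F E) : SmoothFun d X := β.pair (P.sharpSec α)

lemma contr_apply (α β : Covector d F E) (x : X) :
    P.contr α β x = β.toFun x (sharpAt (P.val x) (α.toFun x)) := rfl

lemma contr_antisymm (α β : Covector d F E) : P.contr α β = -P.contr β α := by
  ext x
  exact sharpAt_antisymm (P.val_mem x) _ _

end Bivector

/-- The Poisson bracket of functions. -/
def Bivector.poisson (P : BivectorField d X) (f g : SmoothFun d X) : SmoothFun d X :=
  P.contr (dcov f) (dcov g)

lemma Bivector.poisson_antisymm (P : BivectorField d X) (f g : SmoothFun d X) :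
    P.poisson f g = -P.poisson g f := P.contr_antisymm _ _

/-- This is the preceding anchor identity for the algebroid `TX`, whose anchor is the identity; a
coordinate field supplies the nonvanishing section. -/
lemma tangent_dcov_bracket [NeZero d] [T2Space X] (u v : VF d X) (f : SmoothFun d X) (x : X) :
    (dcov f).toFun x ((tangent d X).bracket u v x) =
      (dcov ((dcov f).pair v)).toFun x (u x) - (dcov ((dcov f).pair u)).toFun x (v x) := by
  obtain ⟨y, D, U, hx, hU⟩ := exists_coordinates d x
  refine (tangent d X).dcov_anchor_bracket u v (D 0) f fun h => ?_
  have := hU.dual x hx 0 0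
  rw [h] at this
  simp at this

/-- The Jacobiator and the Schouten bracket of `∑ v_i ∧ w_i` match only after symmetrizing in the
two summation indices, not term by term. -/
lemma sum_sum_eq_zero_of_symm {k : ℕ} {J S : Fin k → Fin k → ℝ} (c : ℝ)
    (h : ∀ i j, J i j + J j i = c * (S i j + S j i)) (hS : ∑ i, ∑ j, S i j = 0) :
    ∑ i, ∑ j, J i j = 0 := by
  have h1 : ∑ i, ∑ j, (J i j + J j i) = ∑ i, ∑ j, c * (S i j + S j i) := by simp only [h]
  simp only [Finset.sum_add_distrib, ← Finset.mul_sum] at h1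
  rw [Finset.sum_comm (f := fun i j => J j i), Finset.sum_comm (f := fun i j => S j i), hS] at h1
  linarith

/-- The Jacobi identity for the bracket of functions defined by a Poisson bivector. -/
lemma Bivector.poisson_jacobi [T2Space X] (P : BivectorField d X)
    (hP : (tangent d X).IsPoisson P) (f g h : SmoothFun d X) (x : X) :
    P.poisson f (P.poisson g h) x =
      P.poisson (P.poisson f g) h x + P.poisson g (P.poisson f h) x := by
  rcases Nat.eq_zero_or_pos d with rfl | hd
  · have : Subsingleton (TangentSpace (𝓡 0) x) :=
      inferInstanceAs (Subsingleton (EuclideanSpace ℝ (Fin 0)))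
    have h0 (f g : SmoothFun 0 X) : P.poisson f g x = 0 := by
      simp only [poisson, contr_apply]
      rw [Subsingleton.elim (sharpAt _ _) 0, map_zero]
    simp only [h0, add_zero]
  have : NeZero d := ⟨hd.ne'⟩
  obtain ⟨k, v, w, hvw⟩ := P.exists_presentation x
  have hS := hP x k v w hvw
  let Q (f g : SmoothFun d X) : SmoothFun d X :=
    ∑ i, ((dcov f).pair (v i) * (dcov g).pair (w i) - (dcov f).pair (w i) * (dcov g).pair (v i))
  have hQ (f g : SmoothFun d X) : ∀ᶠ y in 𝓝 x, P.poisson f g y = Q f g y := by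
    filter_upwards [hvw] with y hy
    rw [poisson, contr_apply, hy, sharpAt_sum_ι_mul_ι, map_sum, SmoothFun.sum_apply]
    simp
  have hdQ (f g : SmoothFun d X) (t : TangentSpace (𝓡 d) x) :
      (dcov (P.poisson f g)).toFun x t = ∑ j,
        ((dcov ((dcov f).pair (v j))).toFun x t * (dcov g).toFun x (w j x)
          + (dcov f).toFun x (v j x) * (dcov ((dcov g).pair (w j))).toFun x t
          - (dcov ((dcov f).pair (w j))).toFun x t * (dcov g).toFun x (v j x)
          - (dcov f).toFun x (w j x) * (dcov ((dcov g).pair (v j))).toFun x t) := by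
    rw [dcov_congr (hQ f g)]
    simp only [Q, dcov_sum, dcov_sub, dcov_mul, LinearMap.sum_apply, LinearMap.sub_apply,
      LinearMap.add_apply, LinearMap.smul_apply, smul_eq_mul, Covector.pair_apply]
    exact Finset.sum_congr rfl fun j _ => by ring
  have hb (f g : SmoothFun d X) : P.poisson f g x =
      ∑ i, ((dcov f).toFun x (v i x) * (dcov g).toFun x (w i x)
        - (dcov f).toFun x (w i x) * (dcov g).toFun x (v i x)) := by
    rw [(hQ f g).self_of_nhds, SmoothFun.sum_apply]
    rfl
  -- Contract `[P, P] = 0` with `df`, `dg` and `dh`. The result is twice the Jacobiator, whence the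
  -- constant `1 / 2` below.
  have hS' := congrArg (fun z => ExteriorAlgebra.algebraMapInv (contract ((dcov h).toFun x)
    (contract ((dcov g).toFun x) (contract ((dcov f).toFun x) z)))) hS
  simp only [LieAlgebroid.schouten, map_sum, map_add, map_sub, contract_ι_mul_ι_mul_ι, map_zero,
    ExteriorAlgebra.algebraMap_leftInverse _ _, tangent_dcov_bracket] at hS'
  rw [← sub_eq_zero]
  simp only [hb, hdQ, Finset.mul_sum, Finset.sum_mul, ← Finset.sum_sub_distrib,
    ← Finset.sum_add_distrib]
  refine sum_sum_eq_zero_of_symm (1 / 2) (fun i j => ?_) hS'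
  ring

end Algebroids

/-! ### Top degree forms and Pfaffians -/

section Forms

variable {d : ℕ} {X : Type*} [TopologicalSpace X] [ChartedSpace (EuclideanSpace ℝ (Fin d)) X]
variable {F : Type*} [NormedAddCommGroup F] [NormedSpace ℝ F]
  {E : X → Type*} [TopologicalSpace (TotalSpace F E)] [∀ x, TopologicalSpace (E x)]
  [FiberBundle F E] [∀ x, AddCommGroup (E x)] [∀ x, Module ℝ (E x)] {m : ℕ}

/-- The linear map given by a family of covectors. -/
def coords (α : Fin m → Covector d F E) (x : X) : E x →ₗ[ℝ] (Fin m → ℝ) :=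
  LinearMap.pi fun i => (α i).toFun x

@[simp] lemma coords_apply (α : Fin m → Covector d F E) (x : X) (v : E x) (i : Fin m) :
    coords α x v i = (α i).toFun x v := rfl

variable (m) in
/-- The determinant as an alternating form on `ℝ^m`. -/
def stdForm : (Fin m → ℝ) [⋀^Fin m]→ₗ[ℝ] ℝ := (Pi.basisFun ℝ (Fin m)).det

/-- The wedge product of a family of covectors. -/
def frameForm (α : Fin m → Covector d F E) (x : X) : E x [⋀^Fin m]→ₗ[ℝ] ℝ :=
  (stdForm m).compLinearMap (coords α x)

lemma frameForm_apply (α : Fin m → Covector d F E) (x : X) (v : Fin m → E x) :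
    frameForm α x v = Matrix.det (Matrix.of fun i j => (α i).toFun x (v j)) := rfl

lemma frameForm_smooth (α : Fin m → Covector d F E) (v : Fin m → Sec d F E) :
    ContMDiff (𝓡 d) 𝓘(ℝ, ℝ) ∞ fun x => frameForm α x fun i => v i x := by
  simp only [frameForm_apply, Matrix.det_apply, Matrix.of_apply]
  have : (fun x => ∑ σ : Equiv.Perm (Fin m), Equiv.Perm.sign σ • ∏ i, (α (σ i)).toFun x (v i x)) =
      ⇑(∑ σ : Equiv.Perm (Fin m), ((Equiv.Perm.sign σ : ℤ) : SmoothFun d X) *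
        ∏ i, (α (σ i)).pair (v i)) := by
    ext x
    rw [SmoothFun.sum_apply]
    refine Finset.sum_congr rfl fun σ _ => ?_
    rw [Units.smul_def, zsmul_eq_mul]
    have h1 : (∏ i, (α (σ i)).pair (v i)) x = ∏ i, (α (σ i)).toFun x (v i x) :=
      map_prod (ContMDiffMap.evalRingHom (I := 𝓡 d) (n := ∞) x) _ _
    have h2 : ((((Equiv.Perm.sign σ : ℤ) : SmoothFun d X)) x) = ((Equiv.Perm.sign σ : ℤ) : ℝ) :=
      map_intCast (ContMDiffMap.evalRingHom (I := 𝓡 d) (n := ∞) x) _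
    change _ = ((((Equiv.Perm.sign σ : ℤ) : SmoothFun d X)) x) * (∏ i, (α (σ i)).pair (v i)) x
    rw [h1, h2]
  rw [this]
  exact ContMDiffMap.contMDiff _

lemma IsFrameOn.form_eq {α : Fin m → Covector d F E} {s : Fin m → Sec d F E} {U : Set X}
    (h : IsFrameOn α s U) {x : X} (hx : x ∈ U) (θ : E x [⋀^Fin m]→ₗ[ℝ] ℝ) :
    θ = θ (fun i => s i x) • frameForm α x := by
  have h1 := AlternatingMap.eq_smul_basis_det (h.basis hx) θ
  have h2 : frameForm α x = (h.basis hx).det := by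
    ext v
    rw [frameForm_apply, Module.Basis.det_apply]
    congr 1
  rw [h2]
  have h3 : ⇑(h.basis hx) = fun i => s i x := funext fun i => h.basis_apply hx i
  rwa [h3] at h1

variable [IsManifold (𝓡 d) ∞ X]

/-- The functions `φ(u^n)` for a linear functional `φ` and a smooth family `u` of bivectors in a
fixed vector space, together with their derivatives. -/
lemma exists_pow_functional {V : Type*} [AddCommGroup V] [Module ℝ V] {κ : Type*} [Fintype κ]
    (c : κ → SmoothFun d X) (B : κ → ExteriorAlgebra ℝ V) (hB : ∀ a, B a ∈ ⋀[ℝ]^2 V) (n : ℕ)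
    (φ : ExteriorAlgebra ℝ V →ₗ[ℝ] ℝ) :
    ∃ h : SmoothFun d X, ∀ x, h x = φ ((∑ a, c a x • B a) ^ n) ∧
      ∀ t : TangentSpace (𝓡 d) x, (dcov h).toFun x t =
        n * φ ((∑ a, (dcov (c a)).toFun x t • B a) * (∑ a, c a x • B a) ^ (n - 1)) := by
  induction n generalizing φ with
  | zero =>
    refine ⟨⟨fun _ => φ 1, contMDiff_const⟩, fun x => ⟨by rw [pow_zero]; rfl, fun t => ?_⟩⟩
    rw [dcov_const]
    simp
  | succ n ih =>
    -- One factor `B a` of the product is absorbed into the functional, so the induction has to run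
    -- over all `φ`.
    choose H hH using fun a => ih (φ ∘ₗ LinearMap.mulLeft ℝ (B a))
    have hmem (r : κ → ℝ) : ∑ a, r a • B a ∈ ⋀[ℝ]^2 V :=
      Submodule.sum_mem _ fun a _ => Submodule.smul_mem _ _ (hB a)
    refine ⟨∑ a, c a * H a, fun x => ⟨?_, fun t => ?_⟩⟩
    · rw [SmoothFun.sum_apply, pow_succ', Finset.sum_mul, map_sum]
      refine Finset.sum_congr rfl fun a _ => ?_
      change c a x * H a x = _
      rw [(hH a x).1, smul_mul_assoc, map_smul]
      rfl
    · rw [dcov_sum]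
      simp only [LinearMap.sum_apply, dcov_mul, LinearMap.add_apply, LinearMap.smul_apply,
        smul_eq_mul, (hH _ x).1, (hH _ x).2, LinearMap.comp_apply, LinearMap.mulLeft_apply]
      set u := ∑ a, c a x • B a with hu
      set u' := ∑ a, (dcov (c a)).toFun x t • B a with hu'
      have h1 : ∑ a, φ (B a * u ^ n) * (dcov (c a)).toFun x t = φ (u' * u ^ n) := by
        rw [hu', Finset.sum_mul, map_sum]
        refine Finset.sum_congr rfl fun a _ => ?_
        rw [smul_mul_assoc, map_smul, smul_eq_mul, mul_comm]
      have h2 : ∑ a, c a x * (n * φ (B a * (u' * u ^ (n - 1)))) =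
          n * φ (u * (u' * u ^ (n - 1))) := by
        conv_rhs => rw [hu, Finset.sum_mul, map_sum, Finset.mul_sum]
        refine Finset.sum_congr rfl fun a _ => ?_
        rw [smul_mul_assoc, map_smul, smul_eq_mul]
        ring
      rw [Finset.sum_add_distrib, h1, h2]
      rcases n with _ | n
      · simp
      · have h3 : u * (u' * u ^ (n + 1 - 1)) = u' * u ^ (n + 1) := by
          rw [← mul_assoc, (commute_bivector (hmem _) (hmem _)).eq, mul_assoc, Nat.add_sub_cancel,
            ← pow_succ']
        rw [h3]
        push_cast
        ring

variable [VectorBundle ℝ F E] [ContMDiffVectorBundle ∞ F E (𝓡 d)]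

open ExteriorAlgebra in
/-- A basis-induced spanning family of the bivectors in `ℝ^m`. -/
def stdBivector (p : Fin m × Fin m) : ExteriorAlgebra ℝ (Fin m → ℝ) :=
  ι ℝ ((1 / 2 : ℝ) • Pi.basisFun ℝ (Fin m) p.1) * ι ℝ (Pi.basisFun ℝ (Fin m) p.2)

lemma stdBivector_mem (p : Fin m × Fin m) : stdBivector p ∈ ⋀[ℝ]^2 (Fin m → ℝ) := ι_mul_ι_mem _ _

namespace Bivector

/-- The covectors carry `P` into the exterior algebra of the fixed space `ℝ^m`, where its
coefficients can be differentiated. The sum runs over ordered pairs, hence the factor `1 / 2` in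
`stdBivector`. -/
lemma map_coords_val (P : Bivector d F E) (α : Fin m → Covector d F E) (x : X) :
    ExteriorAlgebra.map (coords α x) (P.val x) =
      ∑ p : Fin m × Fin m, P.contr (α p.1) (α p.2) x • stdBivector p := by
  have h1 := bivector_eq_sum (Pi.basisFun ℝ (Fin m)) (map_mem_extPower (coords α x) (P.val_mem x))
  rw [h1, Fintype.sum_prod_type]
  refine Finset.sum_congr rfl fun i _ => ?_
  rw [sharpAt_map _ (P.val_mem x)]
  have h2 : (Pi.basisFun ℝ (Fin m)).coord i ∘ₗ coords α x = (α i).toFun x := by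
    ext v
    simp
  rw [h2]
  have h3 := (Pi.basisFun ℝ (Fin m)).sum_repr (coords α x (sharpAt (P.val x) ((α i).toFun x)))
  rw [← h3, map_sum, Finset.mul_sum]
  refine Finset.sum_congr rfl fun j _ => ?_
  rw [(ExteriorAlgebra.ι ℝ).map_smul (((Pi.basisFun ℝ (Fin m)).repr _) j), mul_smul_comm]
  rfl

lemma exists_contr_pow {m : ℕ} (P : Bivector d F E) (α : Fin m → Covector d F E) (n : ℕ)
    (φ : ExteriorAlgebra ℝ (Fin m → ℝ) →ₗ[ℝ] ℝ) : ∃ h : SmoothFun d X, ∀ x,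
    h x = φ ((∑ p : Fin m × Fin m, P.contr (α p.1) (α p.2) x • stdBivector p) ^ n) ∧
    ∀ t : TangentSpace (𝓡 d) x, (dcov h).toFun x t =
      n * φ ((∑ p : Fin m × Fin m, (dcov (P.contr (α p.1) (α p.2))).toFun x t • stdBivector p) *
        (∑ p : Fin m × Fin m, P.contr (α p.1) (α p.2) x • stdBivector p) ^ (n - 1)) :=
  exists_pow_functional (fun p : Fin m × Fin m => P.contr (α p.1) (α p.2)) stdBivector
    stdBivector_mem n φ

variable {n : ℕ} (P : Bivector d F E) (α : Fin (2 * n) → Covector d F E)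

/-- The coefficient of `P^n` with respect to a family of `2n` covectors. -/
def pf : SmoothFun d X :=
  (P.exists_contr_pow α n (formFunctional (stdForm (2 * n)))).choose

lemma pf_spec (x : X) : P.pf α x = formFunctional (stdForm (2 * n))
      ((∑ p : Fin (2 * n) × Fin (2 * n), P.contr (α p.1) (α p.2) x • stdBivector p) ^ n) ∧
    ∀ t : TangentSpace (𝓡 d) x, (dcov (P.pf α)).toFun x t =
      n * formFunctional (stdForm (2 * n))
        ((∑ p : Fin (2 * n) × Fin (2 * n),
          (dcov (P.contr (α p.1) (α p.2))).toFun x t • stdBivector p) *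
        (∑ p : Fin (2 * n) × Fin (2 * n), P.contr (α p.1) (α p.2) x • stdBivector p) ^ (n - 1)) :=
  (P.exists_contr_pow α n (formFunctional (stdForm (2 * n)))).choose_spec x

lemma pf_apply (x : X) : P.pf α x = formFunctional (frameForm α x) (P.val x ^ n) := by
  rw [(P.pf_spec α x).1, ← map_coords_val, ← map_pow,
    formFunctional_map _ _ (bivector_pow_mem (P.val_mem x) n)]
  rfl

/-- Top forms are multiples of the frame form, so the single function `P.pf α` controls every
pairing with `P^n`; it is therefore a local generator of the ideal of `P`. -/
lemma formFunctional_pow {s : Fin (2 * n) → Sec d F E} {U : Set X} (h : IsFrameOn α s U) {x : X}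
    (hx : x ∈ U) (θ : E x [⋀^Fin (2 * n)]→ₗ[ℝ] ℝ) :
    formFunctional θ (P.val x ^ n) = θ (fun i => s i x) * P.pf α x := by
  rw [pf_apply, ← formFunctional_smul _ _ _ (bivector_pow_mem (P.val_mem x) n), ← h.form_eq hx]

lemma pf_eq_zero_iff {s : Fin (2 * n) → Sec d F E} {U : Set X} (h : IsFrameOn α s U) {x : X}
    (hx : x ∈ U) : P.pf α x = 0 ↔ P.val x ^ n = 0 := by
  refine ⟨fun h0 => ?_, fun h0 => by rw [pf_apply, h0, map_zero]⟩
  refine eq_zero_of_formFunctional (bivector_pow_mem (P.val_mem x) n) fun θ => ?_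
  rw [P.formFunctional_pow α h hx, h0, mul_zero]

lemma pfaffian_eq_zero_iff (x : X) : P.pfaffian n x = 0 ↔ P.val x ^ n = 0 :=
  ⟨fun h => congrArg Subtype.val h, fun h => Subtype.ext h⟩

end Bivector

end Forms

/-! ### The degeneracy ideal of a Poisson structure and the vector fields preserving it. -/

section Divergence

variable {n : ℕ} {X : Type*} [TopologicalSpace X]
  [ChartedSpace (EuclideanSpace ℝ (Fin (2 * n))) X] [IsManifold (𝓡 (2 * n)) ∞ X]
  {P : BivectorField (2 * n) X}

lemma Bivector.mem_ideal_iff (f : SmoothFun (2 * n) X) : f ∈ P.ideal ↔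
    ∃ η : ∀ x : X, (TangentSpace (𝓡 (2 * n)) x) [⋀^Fin (2 * n)]→ₗ[ℝ] ℝ,
      IsSmoothForm η ∧ ∀ x, f x = formFunctional (η x) (P.val x ^ n) := by
  change (∃ η : ∀ x : X, (TangentSpace (𝓡 (2 * n)) x) [⋀^Fin (2 * n)]→ₗ[ℝ] ℝ, IsSmoothForm η ∧
    ∀ x, f x = exteriorPower.alternatingMapLinearEquiv (η x) (P.pfaffian n x)) ↔ _
  simp only [alternatingMapLinearEquiv_eq]
  rfl

lemma Bivector.pf_mem_ideal (α : Fin (2 * n) → Covector (2 * n) (EuclideanSpace ℝ (Fin (2 * n)))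
    (TangentSpace (𝓡 (2 * n)) : X → Type _)) : P.pf α ∈ P.ideal :=
  (P.mem_ideal_iff _).2 ⟨frameForm α, fun v => frameForm_smooth α v, fun x => P.pf_apply α x⟩

lemma Bivector.exists_eq_mul_pf {α : Fin (2 * n) → Covector (2 * n)
    (EuclideanSpace ℝ (Fin (2 * n))) (TangentSpace (𝓡 (2 * n)) : X → Type _)}
    {D : Fin (2 * n) → VF (2 * n) X} {U : Set X} (h : IsFrameOn α D U) {f : SmoothFun (2 * n) X}
    (hf : f ∈ P.ideal) : ∃ c : SmoothFun (2 * n) X, ∀ y ∈ U, f y = c y * P.pf α y := by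
  obtain ⟨η, hη, hfη⟩ := (P.mem_ideal_iff f).1 hf
  exact ⟨⟨_, hη D⟩, fun y hy => (hfη y).trans (P.formFunctional_pow α h hy _)⟩

lemma extDer_stdBivector {m : ℕ} (N : Matrix (Fin m) (Fin m) ℝ) (q : Fin m × Fin m) :
    extDer (Pi.basisFun ℝ (Fin m)) (Matrix.toLin' N) (stdBivector q) =
      ∑ k, N k q.1 • stdBivector (k, q.2) + ∑ k, N k q.2 • stdBivector (q.1, k) := by
  have hN (l : Fin m) : Matrix.toLin' N (Pi.basisFun ℝ (Fin m) l) =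
      ∑ i, N i l • Pi.basisFun ℝ (Fin m) i := by
    ext j
    simp [Pi.single_apply, Finset.sum_apply]
  rw [stdBivector, extDer_ι_mul_ι, (Matrix.toLin' N).map_smul, hN, hN, Finset.smul_sum, map_sum,
    map_sum, Finset.sum_mul, Finset.mul_sum]
  refine congrArg₂ (· + ·) (Finset.sum_congr rfl fun k _ => ?_)
    (Finset.sum_congr rfl fun k _ => ?_)
  · rw [smul_comm, map_smul, smul_mul_assoc]
    rfl
  · rw [(ExteriorAlgebra.ι ℝ).map_smul (N k q.2), mul_smul_comm]
    rfl

lemma sum_mul_add_mul_smul {M : Type*} [AddCommGroup M] [Module ℝ M] {m : ℕ}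
    (N p : Matrix (Fin m) (Fin m) ℝ) (B : Fin m × Fin m → M) :
    ∑ q : Fin m × Fin m, (∑ l, (N q.1 l * p l q.2 + p q.1 l * N q.2 l)) • B q =
      ∑ q : Fin m × Fin m, p q.1 q.2 • (∑ k, N k q.1 • B (k, q.2) + ∑ k, N k q.2 • B (q.1, k)) := by
  simp only [Finset.sum_add_distrib, smul_add, add_smul,
    Fintype.sum_prod_type, Finset.smul_sum, Finset.sum_smul, smul_smul]
  congr 1
  · rw [Finset.sum_comm]
    conv_rhs => rw [Finset.sum_comm]
    refine Finset.sum_congr rfl fun j _ => ?_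
    rw [Finset.sum_comm]
    refine Finset.sum_congr rfl fun k _ => Finset.sum_congr rfl fun i _ => ?_
    rw [mul_comm]
  · refine Finset.sum_congr rfl fun i _ => ?_
    rw [Finset.sum_comm]

/-- The operation `p ↦ N p + p Nᵀ` on coefficient matrices is the derivation induced by `N` on
bivectors. -/
lemma sum_stdBivector {m : ℕ} (N p : Matrix (Fin m) (Fin m) ℝ) :
    ∑ q : Fin m × Fin m, (∑ l, (N q.1 l * p l q.2 + p q.1 l * N q.2 l)) • stdBivector q =
      extDer (Pi.basisFun ℝ (Fin m)) (Matrix.toLin' N) (∑ q : Fin m × Fin m, p q.1 q.2 •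
        stdBivector q) := by
  rw [extDer_sum, sum_mul_add_mul_smul]
  refine Finset.sum_congr rfl fun q _ => ?_
  rw [extDer_smul, extDer_stdBivector]

lemma smul_extDer_mul_pow {m : ℕ} (N : (Fin m → ℝ) →ₗ[ℝ] (Fin m → ℝ))
    {u : ExteriorAlgebra ℝ (Fin m → ℝ)} (hu : u ∈ ⋀[ℝ]^2 (Fin m → ℝ)) (n : ℕ) :
    (n : ℝ) • (extDer (Pi.basisFun ℝ (Fin m)) N u * u ^ (n - 1)) =
      extDer (Pi.basisFun ℝ (Fin m)) N (u ^ n) := by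
  -- For `n = 0` the exponent `n - 1` is truncated, but both sides vanish.
  rcases n with _ | n
  · simp [extDer, contract_one]
  · rw [extDer_pow_succ _ _ hu]
    push_cast
    rfl

/-- Hamiltonian vector fields preserve the degeneracy ideal of a Poisson structure. -/
lemma Bivector.exists_divergence [T2Space X] (hP : (tangent (2 * n) X).IsPoisson P)
    {x : Fin (2 * n) → SmoothFun (2 * n) X} {D : Fin (2 * n) → VF (2 * n) X} {U : Set X}
    (hU : IsFrameOn (fun i => dcov (x i)) D U) (f : SmoothFun (2 * n) X) :
    ∃ h : SmoothFun (2 * n) X, ∀ y ∈ U,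
      P.poisson f (P.pf fun i => dcov (x i)) y = h y * P.pf (fun i => dcov (x i)) y := by
  -- The factor is the coordinate divergence of the Hamiltonian field of `f`, that is, the trace of
  -- its Jacobian `N`.
  refine ⟨∑ i, (dcov (P.poisson f (x i))).pair (D i), fun y hy => ?_⟩
  set α := fun i => dcov (x i)
  obtain ⟨h1, h2⟩ := P.pf_spec α y
  let p : Matrix (Fin (2 * n)) (Fin (2 * n)) ℝ := fun i j => P.contr (α i) (α j) y
  let N : Matrix (Fin (2 * n)) (Fin (2 * n)) ℝ :=
    fun i l => (dcov (P.poisson f (x i))).toFun y (D l y)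
  set u := ∑ q : Fin (2 * n) × Fin (2 * n), P.contr (α q.1) (α q.2) y • stdBivector q with hu
  have hexp (g : SmoothFun (2 * n) X) (j : Fin (2 * n)) : P.poisson (x j) g y =
      ∑ l, p j l * (dcov g).toFun y (D l y) := by
    have := hU.expand y hy (sharpAt (P.val y) ((α j).toFun y))
    rw [poisson, contr_apply, ← this, map_sum]
    simp only [map_smul, smul_eq_mul]
    rfl
  -- By the Jacobi identity `{f, {x_i, x_j}} = {{f, x_i}, x_j} + {x_i, {f, x_j}}`, and expanding in
  -- coordinates gives the entries of `N p + p Nᵀ`.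
  have hder : ∑ q : Fin (2 * n) × Fin (2 * n), (dcov (P.contr (α q.1) (α q.2))).toFun y
      (P.sharpSec (dcov f) y) • stdBivector q =
      extDer (Pi.basisFun ℝ (Fin (2 * n))) (Matrix.toLin' N) u := by
    rw [hu]
    refine Eq.trans (Finset.sum_congr rfl fun q _ => ?_) (sum_stdBivector N p)
    congr 1
    change P.poisson f (P.poisson (x q.1) (x q.2)) y = _
    rw [P.poisson_jacobi hP, P.poisson_antisymm _ (x q.2)]
    change -(P.poisson (x q.2) (P.poisson f (x q.1)) y) + _ = _
    rw [hexp, hexp, Finset.sum_add_distrib, ← Finset.sum_neg_distrib]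
    congr 1
    refine Finset.sum_congr rfl fun l _ => ?_
    have : p l q.2 = - p q.2 l := by
      change P.contr _ _ y = - P.contr _ _ y
      rw [P.contr_antisymm]
      rfl
    rw [this]
    ring
  change (dcov (P.pf α)).toFun y (P.sharpSec (dcov f) y) = _
  have humem : u ∈ ⋀[ℝ]^2 (Fin (2 * n) → ℝ) :=
    Submodule.sum_mem _ fun q _ => Submodule.smul_mem _ _ (stdBivector_mem q)
  have htop : u ^ n ∈ ⋀[ℝ]^(Module.finrank ℝ (Fin (2 * n) → ℝ)) (Fin (2 * n) → ℝ) := by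
    rw [Module.finrank_fin_fun]
    exact bivector_pow_mem humem n
  have htr : ∑ i, (Pi.basisFun ℝ (Fin (2 * n))).coord i
      (Matrix.toLin' N (Pi.basisFun ℝ (Fin (2 * n)) i)) = ∑ i, N i i := by
    simp
  rw [h2, h1, hder, ← smul_eq_mul, ← map_smul, smul_extDer_mul_pow _ humem, extDer_top _ _ htop, map_smul, htr,
    SmoothFun.sum_apply]
  rfl

lemma preserves_of_locally {I : Ideal (SmoothFun (2 * n) X)} (hI : IsDivisorIdeal I)
    {V : VF (2 * n) X} (h : ∀ f ∈ I, ∀ x₀ : X, ∃ g ∈ I, ∀ᶠ y in 𝓝 x₀,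
      (dcov f).toFun y (V y) = g y) : Preserves V I :=
  fun f hf => ⟨(dcov f).pair V, hI.mem_of_locally _ (h f hf), fun _ => rfl⟩

variable [T2Space X]

/-- Writing `f = k G` on `U` gives `V f = (V k + k c) G`, so it suffices to test a vector field on
the generator. -/
lemma Bivector.exists_mem_of_dir_pf {x : Fin (2 * n) → SmoothFun (2 * n) X}
    {D : Fin (2 * n) → VF (2 * n) X} {U : Set X} (hU : IsFrameOn (fun i => dcov (x i)) D U)
    {V : VF (2 * n) X} {c : SmoothFun (2 * n) X}
    (hc : ∀ y ∈ U, (dcov (P.pf fun i => dcov (x i))).toFun y (V y) =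
      c y * P.pf (fun i => dcov (x i)) y) {f : SmoothFun (2 * n) X} (hf : f ∈ P.ideal) :
    ∃ g ∈ P.ideal, ∀ y ∈ U, (dcov f).toFun y (V y) = g y := by
  obtain ⟨k, hk⟩ := exists_eq_mul_pf hU hf
  refine ⟨((dcov k).pair V + k * c) * P.pf fun i => dcov (x i),
    Ideal.mul_mem_left _ _ (P.pf_mem_ideal _), fun y hy => ?_⟩
  have h1 : (dcov f).toFun y = (dcov (k * P.pf fun i => dcov (x i))).toFun y :=
    dcov_congr (Filter.eventually_of_mem (hU.isOpen.mem_nhds hy) hk)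
  rw [h1, dcov_mul, LinearMap.add_apply, LinearMap.smul_apply, LinearMap.smul_apply, hc y hy]
  change k y • _ + P.pf (fun i => dcov (x i)) y • _ =
    ((dcov k).toFun y (V y) + k y * c y) * P.pf (fun i => dcov (x i)) y
  simp only [smul_eq_mul]
  ring

/-- A vector field supported in a coordinate neighbourhood preserves the ideal as soon as its
derivative of the local generator is a multiple of the generator. -/
lemma Bivector.preserves_fsmul (hI : IsDivisorIdeal P.ideal)
    {x : Fin (2 * n) → SmoothFun (2 * n) X}
    {D : Fin (2 * n) → VF (2 * n) X} {U : Set X} (hU : IsFrameOn (fun i => dcov (x i)) D U)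
    {V : VF (2 * n) X} {c : SmoothFun (2 * n) X}
    (hc : ∀ y ∈ U, (dcov (P.pf fun i => dcov (x i))).toFun y (V y) =
      c y * P.pf (fun i => dcov (x i)) y) {χ : SmoothFun (2 * n) X} (hχ : tsupport χ ⊆ U) :
    Preserves (fsmul χ V) P.ideal := by
  refine preserves_of_locally hI fun f hf x₀ => ?_
  by_cases hx : x₀ ∈ U
  · obtain ⟨g, hg, hgU⟩ := exists_mem_of_dir_pf hU hc hf
    refine ⟨χ * g, Ideal.mul_mem_left _ _ hg,
      Filter.eventually_of_mem (hU.isOpen.mem_nhds hx) fun y hy => ?_⟩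
    rw [fsmul_apply, map_smul, hgU y hy]
    rfl
  · refine ⟨0, zero_mem _, ?_⟩
    have : (tsupport χ)ᶜ ∈ 𝓝 x₀ := (isClosed_tsupport χ).isOpen_compl.mem_nhds fun h => hx (hχ h)
    filter_upwards [this] with y hy
    rw [fsmul_apply, image_eq_zero_of_notMem_tsupport hy, zero_smul, map_zero]
    rfl

lemma Bivector.preserves_hamiltonian (hI : IsDivisorIdeal P.ideal)
    (hP : (tangent (2 * n) X).IsPoisson P) (f : SmoothFun (2 * n) X) :
    Preserves (P.sharpSec (dcov f)) P.ideal := by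
  refine preserves_of_locally hI fun g hg x₀ => ?_
  obtain ⟨x, D, U, hx, hU⟩ := exists_coordinates (2 * n) x₀
  obtain ⟨c, hc⟩ := exists_divergence hP hU f
  obtain ⟨g', hg', h⟩ := exists_mem_of_dir_pf hU hc hg
  exact ⟨g', hg', Filter.eventually_of_mem (hU.isOpen.mem_nhds hx) h⟩

end Divergence

/-! ### Lifting bivectors along the anchor -/

section Push

variable {d : ℕ} {X : Type*} [TopologicalSpace X] [ChartedSpace (EuclideanSpace ℝ (Fin d)) X]
  [IsManifold (𝓡 d) ∞ X]
variable {F : Type*} [NormedAddCommGroup F] [NormedSpace ℝ F]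
  {E : X → Type*} [TopologicalSpace (TotalSpace F E)] [∀ x, TopologicalSpace (E x)]
  [FiberBundle F E] [∀ x, AddCommGroup (E x)] [∀ x, Module ℝ (E x)]
  [VectorBundle ℝ F E] [ContMDiffVectorBundle ∞ F E (𝓡 d)]

/-- The constant function with value `c`. -/
def constFun (c : ℝ) : SmoothFun d X := ⟨fun _ => c, contMDiff_const⟩

omit [IsManifold (𝓡 d) ∞ X] in
@[simp] lemma constFun_apply (c : ℝ) (x : X) : (constFun c : SmoothFun d X) x = c := rfl

namespace Bivector

/-- The bivector `∑ v_i ∧ w_i`. -/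
def ofSections {k : ℕ} (v w : Fin k → Sec d F E) : Bivector d F E where
  toFun x := ⟨∑ i, ExteriorAlgebra.ι ℝ (v i x) * ExteriorAlgebra.ι ℝ (w i x),
    Submodule.sum_mem _ fun _ _ => ι_mul_ι_mem _ _⟩
  smooth _ := ⟨k, v, w, Eventually.of_forall fun _ => rfl⟩

lemma ofSections_val {k : ℕ} (v w : Fin k → Sec d F E) (x : X) : (ofSections v w).val x =
    ∑ i, ExteriorAlgebra.ι ℝ (v i x) * ExteriorAlgebra.ι ℝ (w i x) := rfl

end Bivector

namespace LieAlgebroid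

variable (A : LieAlgebroid d X F E)

/-- The bivector field `⋀²ρ(Q)`. -/
def push (Q : Bivector d F E) : BivectorField d X where
  toFun x := exteriorPower.map 2 (A.anchor x) (Q.toFun x)
  smooth x₀ := by
    obtain ⟨k, v, w, h⟩ := Q.exists_presentation x₀
    refine ⟨k, fun i => A.anchorSec (v i), fun i => A.anchorSec (w i), ?_⟩
    filter_upwards [h] with x hx
    rw [exteriorPower_map_coe]
    change ExteriorAlgebra.map (A.anchor x) (Q.val x) = _
    rw [hx, map_sum]
    simp only [map_mul, ExteriorAlgebra.map_apply_ι, anchorSec_apply]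

lemma push_val (Q : Bivector d F E) (x : X) :
    (A.push Q).val x = ExteriorAlgebra.map (A.anchor x) (Q.val x) :=
  exteriorPower_map_coe _ _

lemma isLift_iff (Q : Bivector d F E) (P : BivectorField d X) :
    A.IsLift Q P ↔ ∀ x, ExteriorAlgebra.map (A.anchor x) (Q.val x) = P.val x := by
  refine forall_congr' fun x => ?_
  rw [← A.push_val]
  exact Subtype.ext_iff

lemma map_anchor_injective {x : X} (h : Function.Bijective (A.anchor x)) :
    Function.Injective (ExteriorAlgebra.map (A.anchor x)) := by
  let e := LinearEquiv.ofBijective (A.anchor x) h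
  exact ExteriorAlgebra.map_injective (f := A.anchor x)
    ⟨e.symm.toLinearMap, LinearMap.ext fun v => e.symm_apply_apply v⟩

end LieAlgebroid

variable [T2Space X] [FiniteDimensional ℝ F]

lemma exists_section (x₀ : X) (v : E x₀) : ∃ s : Sec d F E, s x₀ = v := by
  obtain ⟨α, s, U, hx, hU⟩ := exists_frame d F E x₀
  refine ⟨∑ i, fsmul (constFun ((α i).toFun x₀ v)) (s i), ?_⟩
  rw [Sec.sum_apply]
  exact hU.expand x₀ hx v

lemma exists_covector (x₀ : X) (β : Module.Dual ℝ (E x₀)) :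
    ∃ α : Covector d F E, α.toFun x₀ = β := by
  obtain ⟨α, s, U, hx, hU⟩ := exists_frame d F E x₀
  refine ⟨⟨fun x => ∑ i, β (s i x₀) • (α i).toFun x, fun t => ?_⟩, ?_⟩
  · have := (∑ i, constFun (β (s i x₀)) * (α i).pair t : SmoothFun d X).contMDiff
    refine this.congr fun x => ?_
    rw [SmoothFun.sum_apply, LinearMap.sum_apply]
    rfl
  · ext v
    conv_rhs => rw [← hU.expand x₀ hx v, map_sum]
    rw [LinearMap.sum_apply]
    refine Finset.sum_congr rfl fun i _ => ?_
    rw [map_smul, LinearMap.smul_apply, smul_eq_mul, smul_eq_mul, mul_comm]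

/-- A bivector is determined by its pairings with a coframe, and these are continuous functions. -/
lemma Bivector.val_eq_of_dense {P Q : Bivector d F E} {U D : Set X} (hU : IsOpen U)
    (hD : Dense D) (h : ∀ x ∈ U, x ∈ D → P.val x = Q.val x) {x : X} (hx : x ∈ U) :
    P.val x = Q.val x := by
  obtain ⟨α, s, U', hx', hU'⟩ := exists_frame d F E x
  have h1 (i) : sharpAt (P.val x) ((α i).toFun x) = sharpAt (Q.val x) ((α i).toFun x) := by
    refine hU'.ext hx' fun j => ?_
    have := eq_zero_of_dense (f := ⇑(P.contr (α i) (α j) - Q.contr (α i) (α j)))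
      (ContMDiffMap.contMDiff _).continuous.continuousOn hU hD (fun y hy hyD => by
        change P.contr (α i) (α j) y - Q.contr (α i) (α j) y = 0
        rw [contr_apply, contr_apply, h y hy hyD, sub_self]) hx
    exact sub_eq_zero.1 this
  rw [bivector_eq_sum (hU'.basis hx') (P.val_mem x),
    bivector_eq_sum (hU'.basis hx') (Q.val_mem x)]
  simp only [hU'.basis_coord, h1]

lemma LieAlgebroid.val_eq_of_map_eq (A : LieAlgebroid d X F E) {U D : Set X} (hU : IsOpen U)
    (hD : Dense D) (hA : ∀ x ∈ D, Function.Bijective (A.anchor x)) {P Q : Bivector d F E}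
    (h : ∀ x ∈ U, ExteriorAlgebra.map (A.anchor x) (P.val x) =
      ExteriorAlgebra.map (A.anchor x) (Q.val x)) {x : X} (hx : x ∈ U) : P.val x = Q.val x :=
  Bivector.val_eq_of_dense hU hD
    (fun y hy hyD => A.map_anchor_injective (hA y hyD) (h y hy)) hx

/-- Local lifts of a bivector field along a generically bijective anchor glue. -/
lemma LieAlgebroid.exists_isLift (A : LieAlgebroid d X F E) {D : Set X}
    (hD : Dense D) (hA : ∀ x ∈ D, Function.Bijective (A.anchor x)) (P : BivectorField d X)
    (h : ∀ x₀ : X, ∃ (Q : Bivector d F E) (U : Set X), IsOpen U ∧ x₀ ∈ U ∧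
      ∀ x ∈ U, ExteriorAlgebra.map (A.anchor x) (Q.val x) = P.val x) :
    ∃ Q : Bivector d F E, A.IsLift Q P := by
  choose Q U hUo hxU hQ using h
  -- The value at `x` is read off the lift chosen for `x`. Near `x₀` it agrees with the lift chosen
  -- for `x₀`, by uniqueness on the overlap, and so is smooth.
  refine ⟨⟨fun x => (Q x).toFun x, fun x₀ => ?_⟩, (A.isLift_iff _ _).2 fun x => hQ x x (hxU x)⟩
  obtain ⟨k, v, w, hvw⟩ := (Q x₀).exists_presentation x₀
  refine ⟨k, v, w, ?_⟩
  filter_upwards [hvw, (hUo x₀).mem_nhds (hxU x₀)] with x hx hxU'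
  rw [← hx]
  exact A.val_eq_of_map_eq ((hUo x).inter (hUo x₀)) hD hA
    (fun y hy => (hQ x y hy.1).trans (hQ x₀ y hy.2).symm) ⟨hxU x, hxU'⟩

/-! ### Lifts of Poisson structures are Poisson -/

lemma LieAlgebroid.anchor_bracket [NeZero d] (A : LieAlgebroid d X F E) (u v : Sec d F E) {x : X}
    (hx : Nontrivial (E x)) :
    A.anchor x (A.bracket u v x) = (tangent d X).bracket (A.anchorSec u) (A.anchorSec v) x := by
  obtain ⟨w₀, hw₀⟩ := exists_ne (0 : E x)
  obtain ⟨w, rfl⟩ := exists_section (d := d) (F := F) x w₀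
  obtain ⟨y, D, U, hxU, hU⟩ := exists_coordinates d x
  refine hU.ext hxU fun i => ?_
  rw [A.dcov_anchor_bracket u v w _ hw₀, tangent_dcov_bracket]
  rfl

lemma contract_mem_extPower {V : Type*} [AddCommGroup V] [Module ℝ V] {k : ℕ} (β : Module.Dual ℝ V)
    {x : ExteriorAlgebra ℝ V} (hx : x ∈ ⋀[ℝ]^(k + 1) V) : contract β x ∈ ⋀[ℝ]^k V := by
  -- The predicate treats degree `0`, where the contraction vanishes, separately from degree `k +
  -- 1`, which avoids truncated subtraction.
  refine extPower_induction (p := fun m x => (m = 0 → contract β x = 0) ∧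
    ∀ k, m = k + 1 → contract β x ∈ ⋀[ℝ]^k V) (fun r => ⟨fun _ => contract_algebraMap β r,
    fun k hk => absurd hk (by omega)⟩)
    (fun k x y hx hy => ⟨fun h => by rw [map_add, hx.1 h, hy.1 h, add_zero],
      fun k hk => by rw [map_add]; exact add_mem (hx.2 k hk) (hy.2 k hk)⟩)
    (fun m v x hx h => ⟨fun h => absurd h (by omega), fun k hk => ?_⟩) hx |>.2 k rfl
  obtain rfl : m = k := by omega
  rw [contract_ι_mul]
  refine sub_mem (Submodule.smul_mem _ _ hx) ?_
  rcases m with _ | m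
  · rw [h.1 rfl, mul_zero]
    exact zero_mem _
  · exact mem_extPower_succ _ (h.2 m rfl)

lemma eq_zero_of_contract₃ {V : Type*} [AddCommGroup V] [Module ℝ V] [FiniteDimensional ℝ V]
    {x : ExteriorAlgebra ℝ V} (hx : x ∈ ⋀[ℝ]^3 V)
    (h : ∀ α β γ : Module.Dual ℝ V, contract γ (contract β (contract α x)) = 0) : x = 0 := by
  let b := Module.finBasis ℝ V
  exact eq_zero_of_contract_eq_zero b (by norm_num) hx fun α =>
    eq_zero_of_contract_eq_zero b (by norm_num) (contract_mem_extPower α hx) fun β =>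
    eq_zero_of_contract_eq_zero b (by norm_num)
      (contract_mem_extPower β (contract_mem_extPower α hx)) fun γ => h α β γ

namespace LieAlgebroid

variable (A : LieAlgebroid d X F E)

lemma schouten_mem (v w v' w' : Sec d F E) (x : X) : A.schouten v w v' w' x ∈ ⋀[ℝ]^3 (E x) := by
  have h (a b c : E x) : ExteriorAlgebra.ι ℝ a * ExteriorAlgebra.ι ℝ b * ExteriorAlgebra.ι ℝ c ∈
      ⋀[ℝ]^3 (E x) := by
    rw [mul_assoc]
    exact mem_extPower_succ _ (ι_mul_ι_mem _ _)
  exact add_mem (sub_mem (sub_mem (h _ _ _) (h _ _ _)) (h _ _ _)) (h _ _ _)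

/-- The contraction of a decomposable trivector with three covectors. -/
def detFun (α β γ : Covector d F E) (a b c : Sec d F E) : SmoothFun d X :=
  α.pair a * (β.pair b * γ.pair c - β.pair c * γ.pair b)
    - α.pair b * (β.pair a * γ.pair c - β.pair c * γ.pair a)
    + α.pair c * (β.pair a * γ.pair b - β.pair b * γ.pair a)

lemma contract₃_schouten (α β γ : Covector d F E) (v w v' w' : Sec d F E) (x : X) :
    contract (γ.toFun x) (contract (β.toFun x) (contract (α.toFun x)
      (A.schouten v w v' w' x))) = algebraMap ℝ _
      ((detFun α β γ (A.bracket v v') w w' - detFun α β γ (A.bracket v w') w v'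
        - detFun α β γ (A.bracket w v') v w' + detFun α β γ (A.bracket w w') v v') x) := by
  have h (f g : SmoothFun d X) : (f - g) x = f x - g x := rfl
  have h' (f g : SmoothFun d X) : (f + g) x = f x + g x := rfl
  have hdet (a b c : Sec d F E) : contract (γ.toFun x) (contract (β.toFun x)
      (contract (α.toFun x) (ExteriorAlgebra.ι ℝ (a x) * ExteriorAlgebra.ι ℝ (b x) *
        ExteriorAlgebra.ι ℝ (c x)))) = algebraMap ℝ _ (detFun α β γ a b c x) :=
    contract_ι_mul_ι_mul_ι _ _ _ _ _ _
  rw [h', h, h, map_add, map_sub, map_sub]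
  simp only [schouten, LinearMap.map_add, LinearMap.map_sub, hdet]

lemma map_schouten [NeZero d] (v w v' w' : Sec d F E) {x : X} (hx : Nontrivial (E x)) :
    ExteriorAlgebra.map (A.anchor x) (A.schouten v w v' w' x) =
      (tangent d X).schouten (A.anchorSec v) (A.anchorSec w) (A.anchorSec v') (A.anchorSec w') x := by
  simp only [schouten, map_add, map_sub, map_mul, ExteriorAlgebra.map_apply_ι, A.anchor_bracket _ _ hx,
    anchorSec_apply]

lemma schouten_eq_zero_of_subsingleton (v w v' w' : Sec d F E) {x : X} [Subsingleton (E x)] :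
    A.schouten v w v' w' x = 0 := by
  have h (s : E x) : ExteriorAlgebra.ι ℝ s = 0 := by rw [Subsingleton.elim s 0, map_zero]
  simp [schouten, h]

/-- Over `D` the map induced by the anchor is injective and intertwines the Schouten brackets, so
`[Q, Q]` vanishes there; its triple contractions are smooth, so it vanishes everywhere. -/
lemma isPoisson_of_isLift {D : Set X} (hD : Dense D)
    (hA : ∀ x ∈ D, Function.Bijective (A.anchor x)) {P : BivectorField d X} {Q : Bivector d F E}
    (hQ : A.IsLift Q P) (hP : (tangent d X).IsPoisson P) : A.IsPoisson Q := by
  intro x₀ k v w hvw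
  obtain ⟨N, hN, hNo, hxN⟩ := eventually_nhds_iff.1 hvw
  have hzero : ∀ y ∈ N, y ∈ D → ∑ i, ∑ j, A.schouten (v i) (w i) (v j) (w j) y = 0 := by
    intro y hyN hyD
    -- The compatibility of the anchor with brackets needs a nonzero vector in the fibre; in a zero
    -- fibre there is nothing to prove.
    rcases subsingleton_or_nontrivial (E y) with h | h
    · simp only [schouten_eq_zero_of_subsingleton, Finset.sum_const_zero]
    have hd : NeZero d := ⟨by
      rintro rfl
      have : Subsingleton (TangentSpace (𝓡 0) y) :=
        inferInstanceAs (Subsingleton (EuclideanSpace ℝ (Fin 0)))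
      exact not_subsingleton _ (hA y hyD).1.subsingleton⟩
    refine A.map_anchor_injective (hA y hyD) ?_
    simp only [map_zero, map_sum, A.map_schouten _ _ _ _ h]
    refine hP y k _ _ ?_
    filter_upwards [hNo.mem_nhds hyN] with z hz
    change P.val z = _
    rw [← (A.isLift_iff Q P).1 hQ z, show Q.val z = _ from hN z hz, map_sum]
    simp only [map_mul, ExteriorAlgebra.map_apply_ι, anchorSec_apply]
  obtain ⟨_, _, U, hxU, hU⟩ := exists_frame d F E x₀
  have := (hU.basis hxU).finiteDimensional_of_finite
  refine eq_zero_of_contract₃ (Submodule.sum_mem _ fun i _ => Submodule.sum_mem _ fun j _ =>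
    A.schouten_mem _ _ _ _ _) fun α₀ β₀ γ₀ => ?_
  obtain ⟨α, rfl⟩ := exists_covector (d := d) (F := F) x₀ α₀
  obtain ⟨β, rfl⟩ := exists_covector (d := d) (F := F) x₀ β₀
  obtain ⟨γ, rfl⟩ := exists_covector (d := d) (F := F) x₀ γ₀
  let T : SmoothFun d X := ∑ i, ∑ j,
    (detFun α β γ (A.bracket (v i) (v j)) (w i) (w j)
      - detFun α β γ (A.bracket (v i) (w j)) (w i) (v j)
      - detFun α β γ (A.bracket (w i) (v j)) (v i) (w j)
      + detFun α β γ (A.bracket (w i) (w j)) (v i) (v j))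
  have hT (y : X) : contract (γ.toFun y) (contract (β.toFun y) (contract (α.toFun y)
      (∑ i, ∑ j, A.schouten (v i) (w i) (v j) (w j) y))) = algebraMap ℝ _ (T y) := by
    simp only [T, map_sum, contract₃_schouten, SmoothFun.sum_apply]
  rw [hT, eq_zero_of_dense (f := T) T.contMDiff.continuous.continuousOn hNo hD
    (fun y hyN hyD => ?_) hxN, map_zero]
  have h := hT y
  rw [hzero y hyN hyD] at h
  simp only [map_zero] at h
  exact (ExteriorAlgebra.algebraMap_eq_zero_iff _ _).1 h.symm

end LieAlgebroid

end Push

/-! ### The ideal Lie algebroid of a Poisson structure: generic isomorphism and local lifts. -/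

section IdealAlgebroid

variable {n : ℕ} {X : Type*} [TopologicalSpace X] [T2Space X]
  [ChartedSpace (EuclideanSpace ℝ (Fin (2 * n))) X] [IsManifold (𝓡 (2 * n)) ∞ X]
  {P : BivectorField (2 * n) X}
  {F : Type*} [NormedAddCommGroup F] [NormedSpace ℝ F] [FiniteDimensional ℝ F]
  {E : X → Type*} [TopologicalSpace (TotalSpace F E)] [∀ x, TopologicalSpace (E x)]
  [∀ x, AddCommGroup (E x)] [∀ x, Module ℝ (E x)] [FiberBundle F E] [VectorBundle ℝ F E]
  [ContMDiffVectorBundle ∞ F E (𝓡 (2 * n))] {A : LieAlgebroid (2 * n) X F E}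

lemma Bivector.dense_pow_ne_zero (h : IsNowhereDense {x : X | P.pfaffian n x = 0}) :
    Dense {x : X | P.val x ^ n ≠ 0} := by
  have h1 : interior {x : X | P.pfaffian n x = 0} = ∅ :=
    Set.subset_empty_iff.1 ((interior_mono subset_closure).trans h.subset)
  have h2 := interior_eq_empty_iff_dense_compl.1 h1
  convert h2 using 1
  ext x
  simp only [Set.mem_ofPred_eq, Set.mem_compl_iff, P.pfaffian_eq_zero_iff, ne_eq]

/-- The field `G ∂_l` differentiates `G` to `(∂_l G) G`, so it preserves the ideal. -/
lemma Bivector.exists_anchor_eq_fsmul (hI : IsDivisorIdeal P.ideal)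
    (hA : A.IsIdealLieAlgebroid P.ideal)
    {x : Fin (2 * n) → SmoothFun (2 * n) X} {D : Fin (2 * n) → VF (2 * n) X} {U : Set X}
    (hU : IsFrameOn (fun i => dcov (x i)) D U) {χ : SmoothFun (2 * n) X} (hχ : tsupport χ ⊆ U)
    (l : Fin (2 * n)) : ∃ t : Sec (2 * n) F E,
      ∀ y, A.anchor y (t y) = (χ y * P.pf (fun i => dcov (x i)) y) • D l y := by
  obtain ⟨t, ht⟩ := (hA.2 _).1 (P.preserves_fsmul hI hU
    (V := fsmul (P.pf fun i => dcov (x i)) (D l))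
    (c := (dcov (P.pf fun i => dcov (x i))).pair (D l)) (fun y _ => by
      rw [fsmul_apply, map_smul, smul_eq_mul, mul_comm]; rfl) hχ)
  exact ⟨t, fun y => by rw [ht, fsmul_apply, fsmul_apply, smul_smul]⟩

/-- The anchor of the ideal Lie algebroid is bijective where the Poisson structure is
nondegenerate. -/
lemma Bivector.anchor_bijective (hI : IsDivisorIdeal P.ideal)
    (hA : A.IsIdealLieAlgebroid P.ideal) {y : X} (hy : P.val y ^ n ≠ 0) :
    Function.Bijective (A.anchor y) := by
  obtain ⟨x, D, U, hyU, hU⟩ := exists_coordinates (2 * n) y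
  obtain ⟨χ, ⟨V, hV, hyV, -, hχ⟩, hχU⟩ :=
    exists_bump (d := 2 * n) (hU.isOpen.mem_nhds hyU)
  choose t ht using exists_anchor_eq_fsmul hI hA hU hχU
  have hG : P.pf (fun i => dcov (x i)) y ≠ 0 := fun h => hy ((P.pf_eq_zero_iff _ hU hyU).1 h)
  set G := P.pf fun i => dcov (x i)
  constructor
  · rw [injective_iff_map_eq_zero]
    intro v hv
    obtain ⟨s, rfl⟩ := exists_section (d := 2 * n) (F := F) y v
    -- Both sides have the same anchor, so they are equal as sections. At `y` the right side
    -- vanishes when `ρ(s y) = 0`, while the left is a nonzero multiple of `s y`.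
    have h1 : fsmul (χ * G) s = ∑ l, fsmul ((dcov (x l)).pair (A.anchorSec s)) (t l) := by
      refine hA.1 _ _ fun z => ?_
      rw [Sec.sum_apply, map_sum]
      simp only [fsmul_apply, map_smul, ht]
      change (χ z * G z) • _ = _
      by_cases hz : z ∈ U
      · rw [← hU.expand z hz (A.anchor z (s z)), Finset.smul_sum]
        exact Finset.sum_congr rfl fun l _ => smul_comm _ _ _
      · have : χ z = 0 := image_eq_zero_of_notMem_tsupport fun h => hz (hχU h)
        simp [this]
    have h2 := congrArg (fun s : Sec (2 * n) F E => s y) h1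
    simp only [Sec.sum_apply, fsmul_apply, Covector.pair_apply, LieAlgebroid.anchorSec_apply, hv,
      map_zero, zero_smul, Finset.sum_const_zero] at h2
    change (χ y * G y) • _ = _ at h2
    rw [hχ y hyV, one_mul] at h2
    exact (smul_eq_zero.1 h2).resolve_left hG
  · intro v
    refine ⟨∑ l, ((dcov (x l)).toFun y v / G y) • t l y, ?_⟩
    rw [map_sum]
    conv_rhs => rw [← hU.expand y hyU v]
    refine Finset.sum_congr rfl fun l _ => ?_
    rw [map_smul, ht, hχ y hyV, one_mul, smul_smul, div_mul_cancel₀ _ hG]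

/-- Local existence of the lift. -/
lemma Bivector.exists_local_lift (hI : IsDivisorIdeal P.ideal)
    (hA : A.IsIdealLieAlgebroid P.ideal) (hP : (tangent (2 * n) X).IsPoisson P)
    (hD : Dense {x : X | P.val x ^ n ≠ 0}) (x₀ : X) :
    ∃ (Q : Bivector (2 * n) F E) (U : Set X), IsOpen U ∧ x₀ ∈ U ∧
      ∀ x ∈ U, ExteriorAlgebra.map (A.anchor x) (Q.val x) = P.val x := by
  obtain ⟨x, D, U, hxU, hU⟩ := exists_coordinates (2 * n) x₀
  obtain ⟨α, s, U', hxU', hU'⟩ := exists_frame (2 * n) F E x₀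
  -- Two nested cutoffs are needed: the lift of `W` is faithful only on `V`, where `χ = 1`, and the
  -- fields `Y i` are then cut off inside `V`.
  obtain ⟨χ, ⟨V, hV, hxV, hVU, hχ⟩, hχU⟩ := exists_bump (d := 2 * n)
    ((hU.isOpen.inter hU'.isOpen).mem_nhds ⟨hxU, hxU'⟩)
  obtain ⟨χ', ⟨V', hV', hxV', hVV', hχ'⟩, hχV'⟩ := exists_bump (d := 2 * n) (hV.mem_nhds hxV)
  set G := P.pf fun i => dcov (x i) with hG
  have hGD {y : X} (hy : y ∈ U) (hyD : P.val y ^ n ≠ 0) : G y ≠ 0 := fun h =>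
    hyD ((P.pf_eq_zero_iff _ hU hy).1 h)
  choose h hh using fun l => exists_divergence hP hU (x l)
  choose Xt hXt using fun l => (hA.2 _).1 (P.preserves_hamiltonian hI hP (x l))
  -- This is `P^♯(d log G)`, smooth across the zeros of `G` because `{x_l, G} = h_l G`.
  let W : VF (2 * n) X := ∑ l, fsmul (-(h l)) (D l)
  have hcoord {y : X} (hy : y ∈ U) (c : Fin (2 * n) → SmoothFun (2 * n) X) (i : Fin (2 * n)) :
      (dcov (x i)).toFun y ((∑ l, fsmul (c l) (D l) : VF (2 * n) X) y) = c i y := by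
    rw [Sec.sum_apply, map_sum]
    simp only [fsmul_apply, map_smul, hU.dual y hy, smul_eq_mul, mul_ite, mul_one, mul_zero,
      Finset.sum_ite_eq, Finset.mem_univ, if_true]
  have hW {y : X} (hy : y ∈ U) : G y • W y = sharpAt (P.val y) ((dcov G).toFun y) := by
    refine hU.ext hy fun i => ?_
    rw [map_smul, hcoord hy, sharpAt_antisymm (P.val_mem y)]
    change G y * -(h i y) = - P.poisson (x i) G y
    rw [hh i y hy]
    ring
  -- Skewness gives `G · dG(W) = P(dG, dG) = 0`, and `G` is cancelled on the dense set.
  have hWG : ∀ y ∈ U, (dcov G).toFun y (W y) = (0 : SmoothFun (2 * n) X) y * G y := by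
    intro y hy
    change _ = (0 : ℝ) * _
    rw [zero_mul]
    refine eq_zero_of_dense (f := ⇑((dcov G).pair W))
      (ContMDiffMap.contMDiff _).continuous.continuousOn hU.isOpen hD (fun z hz hzD => ?_) hy
    have h1 := sharpAt_antisymm (P.val_mem z) ((dcov G).toFun z) ((dcov G).toFun z)
    rw [← hW hz, map_smul, smul_eq_mul] at h1
    have h2 : G z * (dcov G).toFun z (W z) = 0 := by linarith
    exact (mul_eq_zero.1 h2).resolve_left (hGD hz hzD)
  obtain ⟨Wt, hWt⟩ := (hA.2 _).1 (P.preserves_fsmul hI hU hWG (hχU.trans Set.inter_subset_left))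
  -- This is the smooth extension of `P^♯(α_i ∘ ρ⁻¹)`: its `l`-th coordinate is minus the pairing of
  -- `α_i` with the lifted Hamiltonian field of `x_l`.
  let Y (i : Fin (Module.finrank ℝ F)) : VF (2 * n) X :=
    ∑ l, fsmul (-((α i).pair (Xt l))) (D l)
  have hY (i) {y : X} (hy : y ∈ U) {β : Module.Dual ℝ (TangentSpace (𝓡 (2 * n)) y)}
      (hβ : β ∘ₗ A.anchor y = (α i).toFun y) : Y i y = sharpAt (P.val y) β := by
    refine hU.ext hy fun l => ?_
    rw [hcoord hy, sharpAt_antisymm (P.val_mem y)]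
    change -((α i).toFun y (Xt l y)) = - β (P.sharpSec (dcov (x l)) y)
    rw [← hβ, LinearMap.comp_apply, hXt]
  have hbij {y : X} (hy : P.val y ^ n ≠ 0) := anchor_bijective hI hA hy
  have hβ (i) {y : X} (hy : P.val y ^ n ≠ 0) :
      ((α i).toFun y ∘ₗ (LinearEquiv.ofBijective _ (hbij hy)).symm.toLinearMap) ∘ₗ A.anchor y =
        (α i).toFun y := by
    ext v
    exact congrArg ((α i).toFun y) ((LinearEquiv.ofBijective _ (hbij hy)).symm_apply_apply v)
  -- With `β = α_i ∘ ρ⁻¹` on the dense set, `dG(P^♯ β) = -β(P^♯ dG) = -G β(W) = -G α_i(Wt)`.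
  have hYG (i) : ∀ y ∈ V, (dcov G).toFun y (Y i y) = (-((α i).pair Wt)) y * G y := by
    intro y hy
    rw [← sub_eq_zero]
    refine eq_zero_of_dense (f := ⇑((dcov G).pair (Y i) - (-((α i).pair Wt)) * G))
      (ContMDiffMap.contMDiff _).continuous.continuousOn hV hD (fun z hz hzD => ?_) hy
    change (dcov G).toFun z (Y i z) - (-((α i).toFun z (Wt z))) * G z = 0
    rw [hY i (hVU hz).1 (hβ i hzD), sharpAt_antisymm (P.val_mem z), ← hW (hVU hz).1, map_smul]
    have h1 : W z = A.anchor z (Wt z) := by rw [hWt, fsmul_apply, hχ z hz, one_smul]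
    rw [h1, ← LinearMap.comp_apply _ (A.anchor z), hβ i hzD, smul_eq_mul]
    ring
  have hUV := hU.mono hV (hVU.trans Set.inter_subset_left)
  choose Yt hYt using fun i => (hA.2 _).1 (P.preserves_fsmul hI hUV (hYG i) hχV')
  -- Over the dense set this is the Euler expansion of `(⋀² ρ)⁻¹ P` in the frame `s`, since there
  -- `Yt i` is the image of `α_i` under its sharp map.
  refine ⟨ofSections (fun i => fsmul (constFun (1 / 2)) (s i)) Yt, V', hV', hxV', fun y hy => ?_⟩
  rw [← A.push_val]
  refine val_eq_of_dense hV' hD (fun z hz hzD => ?_) hy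
  have hzU' : z ∈ U' := (hVU (hVV' hz)).2
  let e := LinearEquiv.ofBijective _ (hbij hzD)
  have h1 := bivector_eq_sum (hU'.basis hzU')
    (map_mem_extPower e.symm.toLinearMap (P.val_mem z))
  have h2 : ExteriorAlgebra.map e.symm.toLinearMap (P.val z) =
      (ofSections (fun i => fsmul (constFun (1 / 2)) (s i)) Yt).val z := by
    rw [h1, ofSections_val]
    refine Finset.sum_congr rfl fun i _ => ?_
    rw [sharpAt_map _ (P.val_mem z), hU'.basis_apply, hU'.basis_coord, ← hY i (hVU (hVV' hz)).1
      (hβ i hzD)]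
    have h3 : Y i z = e (Yt i z) := by
      change _ = A.anchor z (Yt i z)
      rw [hYt, fsmul_apply, hχ' z hz, one_smul]
    rw [h3]
    change _ * ExteriorAlgebra.ι ℝ (e.symm (e (Yt i z))) = _
    rw [e.symm_apply_apply]
    rfl
  have h4 : A.anchor z ∘ₗ e.symm.toLinearMap = LinearMap.id :=
    LinearMap.ext fun v => e.apply_symm_apply v
  rw [A.push_val, ← h2, ← AlgHom.comp_apply, ExteriorAlgebra.map_comp_map, h4,
    ExteriorAlgebra.map_id, AlgHom.id_apply]

end IdealAlgebroid

/-! ### Vector bundles are finitely generated -/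

section Generators

variable {d : ℕ} {X : Type*} [TopologicalSpace X] [ChartedSpace (EuclideanSpace ℝ (Fin d)) X]
  [IsManifold (𝓡 d) ∞ X] [T2Space X]
variable {F : Type*} [NormedAddCommGroup F] [NormedSpace ℝ F] [FiniteDimensional ℝ F]
  {E : X → Type*} [TopologicalSpace (TotalSpace F E)] [∀ x, TopologicalSpace (E x)]
  [FiberBundle F E] [∀ x, AddCommGroup (E x)] [∀ x, Module ℝ (E x)]
  [VectorBundle ℝ F E] [ContMDiffVectorBundle ∞ F E (𝓡 d)]

/-- The sections `s i` span the fibres over `C`. -/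
def SpansOn {κ : Type*} (s : κ → Sec d F E) (C : Set X) : Prop :=
  ∀ x ∈ C, ∀ β : Module.Dual ℝ (E x), (∀ i, β (s i x) = 0) → β = 0

lemma exists_finite_spansOn {C : Set X} (hC : IsCompact C) :
    ∃ (N : ℕ) (s : Fin N → Sec d F E), SpansOn s C := by
  refine hC.induction_on (p := fun C => ∃ (N : ℕ) (s : Fin N → Sec d F E), SpansOn s C)
    ⟨0, fun i => i.elim0, fun x hx => absurd hx (Set.notMem_empty x)⟩
    (fun C C' h ⟨N, s, hs⟩ => ⟨N, s, fun x hx => hs x (h hx)⟩) ?_ fun x _ => ?_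
  · rintro C C' ⟨N, s, hs⟩ ⟨N', s', hs'⟩
    refine ⟨N + N', Fin.append s s', fun x hx β hβ => ?_⟩
    rcases hx with hx | hx
    · exact hs x hx β fun i => by simpa using hβ (Fin.castAdd N' i)
    · exact hs' x hx β fun i => by simpa using hβ (Fin.natAdd N i)
  · obtain ⟨α, s, U, hxU, hU⟩ := exists_frame d F E x
    refine ⟨U, mem_nhdsWithin_of_mem_nhds (hU.isOpen.mem_nhds hxU), _, s, fun y hy β hβ => ?_⟩
    ext v
    rw [← hU.expand y hy v, map_sum]
    simp [hβ]

/-- Near `x₀` the value vectors are the image of a chart ball times the dual fibre under a `C¹` map,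
which does not raise Hausdorff dimension. -/
lemma dimH_values_le {κ : Type*} [Fintype κ] (s : κ → Sec d F E) (x₀ : X) : ∃ V ∈ 𝓝 x₀,
    dimH {w : κ → ℝ | ∃ x ∈ V, ∃ β : Module.Dual ℝ (E x), (fun i => β (s i x)) = w} ≤
      (d + Module.finrank ℝ F : ℕ) := by
  obtain ⟨α, sE, U, hxU, hU⟩ := exists_frame d F E x₀
  let e := extChartAt (𝓡 d) x₀
  have h1 : e.symm ⁻¹' U ∩ e.target ∈ 𝓝 (e x₀) := by
    refine inter_mem ?_ (extChartAt_target_mem_nhds x₀)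
    refine (continuousAt_extChartAt_symm x₀).preimage_mem_nhds ?_
    rw [extChartAt_to_inv]
    exact hU.isOpen.mem_nhds hxU
  obtain ⟨ε, hε, hball⟩ := Metric.mem_nhds_iff.1 h1
  let B := Metric.ball (e x₀) ε
  refine ⟨e.source ∩ e ⁻¹' B, inter_mem (extChartAt_source_mem_nhds x₀)
    ((continuousAt_extChartAt x₀).preimage_mem_nhds (Metric.ball_mem_nhds _ hε)), ?_⟩
  let g : EuclideanSpace ℝ (Fin d) × (Fin (Module.finrank ℝ F) → ℝ) → κ → ℝ :=
    fun p i => ∑ b, p.2 b * (α b).pair (s i) (e.symm p.1)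
  have hg : ContDiffOn ℝ 1 g (B ×ˢ Set.univ) := by
    rw [contDiffOn_pi]
    intro i
    refine ContDiffOn.sum fun b _ => ContDiffOn.mul ?_ ?_
    · exact ((contDiff_apply ℝ ℝ b).comp contDiff_snd).contDiffOn
    · have h2 : ContMDiffOn 𝓘(ℝ, EuclideanSpace ℝ (Fin d)) 𝓘(ℝ, ℝ) ∞
          ((α b).pair (s i) ∘ e.symm) e.target :=
        ((α b).pair (s i)).contMDiff.comp_contMDiffOn (contMDiffOn_extChartAt_symm x₀)
      have h3 : ContDiffOn ℝ 1 ((α b).pair (s i) ∘ e.symm) e.target :=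
        (contMDiffOn_iff_contDiffOn.1 h2).of_le (by simp)
      exact h3.comp contDiff_fst.contDiffOn fun p hp => (hball hp.1).2
  have hsub : {w : κ → ℝ | ∃ x ∈ e.source ∩ e ⁻¹' B, ∃ β : Module.Dual ℝ (E x),
      (fun i => β (s i x)) = w} ⊆ g '' (B ×ˢ Set.univ) := by
    rintro w ⟨x, ⟨hx, hxB⟩, β, rfl⟩
    refine ⟨(e x, fun b => β (sE b x)), ⟨hxB, trivial⟩, ?_⟩
    ext i
    have hxU : x ∈ U := by
      have := (hball hxB).1
      rwa [Set.mem_preimage, e.left_inv hx] at this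
    change ∑ b, β (sE b x) * (α b).toFun (e.symm (e x)) (s i (e.symm (e x))) = _
    rw [e.left_inv hx]
    conv_rhs => rw [← hU.expand x hxU (s i x), map_sum]
    refine Finset.sum_congr rfl fun b _ => ?_
    rw [map_smul, smul_eq_mul, mul_comm]
  calc _ ≤ dimH (g '' (B ×ˢ Set.univ)) := dimH_mono hsub
    _ ≤ dimH (B ×ˢ (Set.univ : Set (Fin (Module.finrank ℝ F) → ℝ))) :=
      hg.dimH_image_le ((convex_ball _ _).prod convex_univ) subset_rfl
    _ ≤ dimH (Set.univ : Set (EuclideanSpace ℝ (Fin d) × (Fin (Module.finrank ℝ F) → ℝ))) :=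
      dimH_mono (Set.subset_univ _)
    _ = _ := by
      rw [Real.dimH_univ_eq_finrank]
      simp

variable [SecondCountableTopology X]

lemma exists_ne_values {κ : Type*} [Fintype κ] (s : κ → Sec d F E)
    (hκ : d + Module.finrank ℝ F < Fintype.card κ) :
    ∃ w : κ → ℝ, ∀ (x : X) (β : Module.Dual ℝ (E x)), (fun i => β (s i x)) ≠ w := by
  choose V hV hdim using dimH_values_le s
  obtain ⟨t, ht, hcov⟩ := TopologicalSpace.countable_cover_nhds hV
  let B (x₀ : X) : Set (κ → ℝ) :=
    {w | ∃ x ∈ V x₀, ∃ β : Module.Dual ℝ (E x), (fun i => β (s i x)) = w}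
  have h1 : dimH (⋃ x₀ ∈ t, B x₀) < Module.finrank ℝ (κ → ℝ) := by
    rw [dimH_bUnion ht, Module.finrank_fintype_fun_eq_card]
    exact (iSup₂_le fun x₀ _ => hdim x₀).trans_lt (by exact_mod_cast hκ)
  obtain ⟨w, hw⟩ := (dense_compl_of_dimH_lt_finrank h1).nonempty
  refine ⟨w, fun x β h => hw ?_⟩
  obtain ⟨x₀, hx₀, hx⟩ := Set.mem_iUnion₂.1 (hcov.symm ▸ Set.mem_univ x)
  exact Set.mem_biUnion hx₀ ⟨x, hx, β, h⟩

/-- A generic projection as in Whitney's theorem: choose `w` that is not the value vector of any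
covector and replace each `s_i` by `s_i - (w_i / w_j) s_j`. A covector killing these has values
proportional to `w`; if they were nonzero, rescaling would produce `w` itself. -/
lemma SpansOn.exists_pred {N : ℕ} (hN : d + Module.finrank ℝ F < N + 1)
    {s : Fin (N + 1) → Sec d F E} {C : Set X} (hs : SpansOn s C) :
    ∃ s' : Fin N → Sec d F E, SpansOn s' C := by
  obtain ⟨w, hw⟩ := exists_ne_values s (by simpa using hN)
  by_cases hC : C = ∅
  · exact ⟨fun _ => 0, fun x hx => absurd hx (hC ▸ Set.notMem_empty x)⟩
  obtain ⟨x₁, -⟩ := Set.nonempty_iff_ne_empty.2 hC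
  obtain ⟨j, hj⟩ : ∃ j, w j ≠ 0 := by
    by_contra! h
    exact hw x₁ 0 (funext fun i => (h i).symm)
  refine ⟨fun i => s (j.succAbove i) - fsmul (constFun (w (j.succAbove i) / w j)) (s j),
    fun x hx β hβ => ?_⟩
  have h1 (i) : β (s i x) = w i * (β (s j x) / w j) := by
    rcases Fin.eq_self_or_eq_succAbove j i with rfl | ⟨i, rfl⟩
    · field_simp
    · have := hβ i
      simp only [ContMDiffSection.coe_sub, Pi.sub_apply, fsmul_apply, constFun_apply, map_sub,
        map_smul, smul_eq_mul] at this
      rw [sub_eq_zero.1 this]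
      ring
  by_cases h0 : β (s j x) = 0
  · exact hs x hx β fun i => by rw [h1, h0, zero_div, mul_zero]
  · refine absurd (funext fun i => ?_) (hw x ((w j / β (s j x)) • β))
    rw [LinearMap.smul_apply, h1 i, smul_eq_mul]
    field_simp

lemma exists_spansOn {C : Set X} (hC : IsCompact C) :
    ∃ s : Fin (d + Module.finrank ℝ F) → Sec d F E, SpansOn s C := by
  obtain ⟨N, s, hs⟩ := exists_finite_spansOn (d := d) (F := F) (E := E) hC
  rcases le_total N (d + Module.finrank ℝ F) with hN | hN
  · refine ⟨fun i => if h : i < N then s ⟨i, h⟩ else 0, fun x hx β hβ => hs x hx β fun i => ?_⟩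
    simpa using hβ ⟨i, i.2.trans_le hN⟩
  · induction N, hN using Nat.le_induction with
    | base => exact ⟨s, hs⟩
    | succ N hN ih =>
      obtain ⟨s', hs'⟩ := hs.exists_pred (Nat.lt_succ_of_le hN)
      exact ih s' hs'

-- Compact shells of an exhaustion, with bumps supported in slightly larger shells. Shells whose
-- indices differ by at least `3` are disjoint, so three colours separate them.
variable (d X) in
lemma exists_annuli : ∃ (C : ℕ → Set X) (χ : ℕ → SmoothFun d X), (∀ k, IsCompact (C k)) ∧
    (⋃ k, C k) = Set.univ ∧ (∀ k, ∀ x ∈ C k, χ k x = 1) ∧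
    LocallyFinite (fun k => {x | χ k x ≠ 0}) ∧
    ∀ k l x, χ k x ≠ 0 → χ l x ≠ 0 → k % 3 = l % 3 → k = l := by
  have := ChartedSpace.locallyCompactSpace (EuclideanSpace ℝ (Fin d)) X
  -- The double shift makes `M 0` and `M 1` empty, so that the shells `C k` with `k ≥ 0` already
  -- cover `X`.
  let M := (CompactExhaustion.choice X).shiftr.shiftr
  have hM1 : M 1 = ∅ := rfl
  let O (k : ℕ) : Set X := interior (M (k + 3)) \ M k
  have hO (k) : IsOpen (O k) := isOpen_interior.sdiff (M.isCompact k).isClosed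
  let C (k : ℕ) : Set X := M (k + 2) \ interior (M (k + 1))
  have hC (k) : IsCompact (C k) := (M.isCompact _).diff isOpen_interior
  have hCO (k) : C k ⊆ O k := fun x hx =>
    ⟨M.subset_interior_succ _ hx.1, fun h => hx.2 (M.subset_interior_succ _ h)⟩
  have hbump (k) : ∃ χ : SmoothFun d X, (∀ x ∉ O k, χ x = 0) ∧ ∀ x ∈ C k, χ x = 1 := by
    obtain ⟨f, hf0, hf1, -⟩ := exists_contMDiffMap_zero_one_of_isClosed (n := ⊤) (𝓡 d)
      (hO k).isClosed_compl (hC k).isClosed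
      (Set.disjoint_left.2 fun x hx hx' => hx (hCO k hx'))
    exact ⟨f, fun x hx => hf0 hx, fun x hx => hf1 hx⟩
  choose χ hχ0 hχ1 using hbump
  have hχ {k x} (h : χ k x ≠ 0) : x ∈ O k := by
    by_contra hx
    exact h (hχ0 k x hx)
  refine ⟨C, χ, hC, Set.eq_univ_of_forall fun x => ?_, hχ1, fun x => ?_, ?_⟩
  · have h1 : x ∈ M (M.find x) := M.mem_find x
    obtain ⟨k, hk⟩ : ∃ k, M.find x = k + 2 := by
      refine Nat.exists_eq_add_of_le' ?_
      by_contra! h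
      have := M.subset (Nat.lt_succ_iff.1 h) h1
      rw [hM1] at this
      exact this
    refine Set.mem_iUnion.2 ⟨k, hk ▸ h1, fun h => ?_⟩
    have := M.mem_iff_find_le.1 (interior_subset h)
    omega
  · obtain ⟨m, hm⟩ := M.exists_mem_nhds x
    refine ⟨M m, hm, (Set.finite_lt_nat m).subset ?_⟩
    rintro k ⟨y, hy, hym⟩
    by_contra h
    exact (hχ hy).2 (M.subset (not_lt.1 h) hym)
  · have key {k l x} (hk : χ k x ≠ 0) (hl : χ l x ≠ 0) : l < k + 3 := by
      by_contra! h
      exact (hχ hl).2 (M.subset h (interior_subset (hχ hk).1))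
    intro k l x hk hl h
    have h1 := key hk hl
    have h2 := key hl hk
    omega

variable (d F E) in
/-- The sections of a vector bundle over a second countable manifold have finitely many
generators. -/
lemma exists_generators : ∃ s : Fin 3 × Fin (d + Module.finrank ℝ F) → Sec d F E,
    SpansOn s Set.univ := by
  obtain ⟨C, χ, hC, hcov, hχ1, hfin, hdisj⟩ := exists_annuli d X
  choose s hs using fun k => exists_spansOn (d := d) (F := F) (E := E) (hC k)
  let t (c : Fin 3) (a : Fin (d + Module.finrank ℝ F)) (k : ℕ) : Sec d F E :=
    if k % 3 = c then fsmul (χ k) (s k a) else 0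
  have ht {c a k x} (h : t c a k x ≠ 0) : k % 3 = c ∧ χ k x ≠ 0 := by
    simp only [t] at h
    split_ifs at h with hk
    · exact ⟨hk, fun h0 => h (by rw [fsmul_apply, h0, zero_smul])⟩
    · exact absurd rfl h
  -- Within one colour at most one summand is nonzero at each point, so the sum restricts to the
  -- chosen generators on each shell. This works because their number does not depend on the shell.
  refine ⟨fun p => ⟨fun x => ∑ᶠ k, t p.1 p.2 k x, ContMDiff.finsum_section_of_locallyFinite
    (hfin.subset fun k x hx => (ht hx).2) fun k => (t p.1 p.2 k).contMDiff⟩, fun x _ β hβ => ?_⟩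
  obtain ⟨k, hk⟩ := Set.mem_iUnion.1 (hcov.symm ▸ Set.mem_univ x)
  refine hs k x hk β fun a => ?_
  have h1 := hβ (⟨k % 3, Nat.mod_lt _ (by norm_num)⟩, a)
  change β (∑ᶠ l, t ⟨k % 3, _⟩ a l x) = 0 at h1
  have h2 : χ k x ≠ 0 := by rw [hχ1 k x hk]; exact one_ne_zero
  rw [finsum_eq_single _ k fun l hl => by
    by_contra h
    exact hl (hdisj l k x (ht h).2 h2 (ht h).1)] at h1
  simp only [t, if_true] at h1
  rwa [fsmul_apply, hχ1 k x hk, one_smul] at h1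

end Generators

/-! ### Standard ideals and nondegenerate lifts -/

section Standard

variable {n : ℕ} {X : Type*} [TopologicalSpace X] [T2Space X]
  [ChartedSpace (EuclideanSpace ℝ (Fin (2 * n))) X] [IsManifold (𝓡 (2 * n)) ∞ X]
  {P : BivectorField (2 * n) X}
  {F : Type*} [NormedAddCommGroup F] [NormedSpace ℝ F] [FiniteDimensional ℝ F]
  {E : X → Type*} [TopologicalSpace (TotalSpace F E)] [∀ x, TopologicalSpace (E x)]
  [∀ x, AddCommGroup (E x)] [∀ x, Module ℝ (E x)] [FiberBundle F E] [VectorBundle ℝ F E]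
  [ContMDiffVectorBundle ∞ F E (𝓡 (2 * n))] {A : LieAlgebroid (2 * n) X F E}
  {Q : Bivector (2 * n) F E}

lemma LieAlgebroid.finrank_eq {x : X} (h : Function.Bijective (A.anchor x)) :
    Module.finrank ℝ F = 2 * n := by
  obtain ⟨α, s, U, hx, hU⟩ := exists_frame (2 * n) F E x
  have h1 := Module.finrank_eq_card_basis (hU.basis hx)
  have h2 := (LinearEquiv.ofBijective _ h).finrank_eq
  have h3 : Module.finrank ℝ (TangentSpace (𝓡 (2 * n)) x) = 2 * n :=
    finrank_euclideanSpace_fin (𝕜 := ℝ) (n := 2 * n)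
  rw [Fintype.card_fin] at h1
  omega

variable (E) in
lemma exists_frame_of_finrank_eq (hF : Module.finrank ℝ F = 2 * n) (x₀ : X) :
    ∃ (α : Fin (2 * n) → Covector (2 * n) F E) (s : Fin (2 * n) → Sec (2 * n) F E)
      (U : Set X), x₀ ∈ U ∧ IsFrameOn α s U := by
  obtain ⟨-, α, s, U, hx, hU, -⟩ :=
    exists_frame_of_trivialization (2 * n) F E (Module.finBasisOfFinrankEq ℝ F hF) x₀
  exact ⟨α, s, U, hx, hU⟩

lemma Bivector.isNondegenerate_iff (hF : Module.finrank ℝ F = 2 * n) :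
    Q.IsNondegenerate ↔ ∀ x, Q.val x ^ n ≠ 0 := by
  refine forall_congr' fun x => ?_
  obtain ⟨α, s, U, hx, hU⟩ := exists_frame_of_finrank_eq E hF x
  have := (hU.basis hx).finiteDimensional_of_finite
  have h1 : Module.finrank ℝ (E x) = 2 * n := by
    rw [Module.finrank_eq_card_basis (hU.basis hx), Fintype.card_fin]
  exact ⟨fun h => bivector_pow_ne_zero h1.ge (Q.val_mem x) h.2,
    fun h => sharpAt_bijective h1 (Q.val_mem x) h⟩

lemma LieAlgebroid.IsLift.formFunctional_eq (hQ : A.IsLift Q P) (x : X)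
    (η : (TangentSpace (𝓡 (2 * n)) x) [⋀^Fin (2 * n)]→ₗ[ℝ] ℝ) :
    formFunctional η (P.val x ^ n) =
      formFunctional (η.compLinearMap (A.anchor x)) (Q.val x ^ n) := by
  rw [← (A.isLift_iff Q P).1 hQ x, ← map_pow,
    formFunctional_map _ _ (bivector_pow_mem (Q.val_mem x) n)]

/-- In frames `G = δ q` with `δ = det ρ` and `q` the coefficient of `Q^n`. If `δ = k G`, then `k q =
1` where `G ≠ 0`, hence everywhere nearby, and `q` has no zero. -/
lemma isNondegenerate_of_divisorIdeal_le (hF : Module.finrank ℝ F = 2 * n)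
    (hD : Dense {x : X | P.val x ^ n ≠ 0}) (hQ : A.IsLift Q P)
    (h : A.divisorIdeal ≤ P.ideal) : Q.IsNondegenerate := by
  rw [Bivector.isNondegenerate_iff hF]
  intro x₀
  obtain ⟨x, D, U, hxU, hU⟩ := exists_coordinates (2 * n) x₀
  obtain ⟨α, s, U', hxU', hU'⟩ := exists_frame_of_finrank_eq E hF x₀
  set G := P.pf fun i => dcov (x i) with hG
  let δ : SmoothFun (2 * n) X :=
    ⟨_, frameForm_smooth (fun i => dcov (x i)) fun i => A.anchorSec (s i)⟩
  have hδ : δ ∈ P.ideal := h (Ideal.subset_span ⟨s, frameForm fun i => dcov (x i),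
    fun v => frameForm_smooth _ v, fun _ => rfl⟩)
  obtain ⟨k, hk⟩ := Bivector.exists_eq_mul_pf hU hδ
  have hGδ : ∀ y ∈ U', G y = δ y * Q.pf α y := fun y hy => by
    rw [hG, P.pf_apply, hQ.formFunctional_eq, Q.formFunctional_pow α hU' hy]
    rfl
  have h1 : k x₀ * Q.pf α x₀ - 1 = 0 := by
    refine eq_zero_of_dense (f := ⇑(k * Q.pf α - constFun 1 : SmoothFun (2 * n) X))
      (ContMDiffMap.contMDiff _).continuous.continuousOn (hU.isOpen.inter hU'.isOpen) hD
      (fun z hz hzD => ?_) ⟨hxU, hxU'⟩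
    have h2 : G z ≠ 0 := fun h => hzD ((P.pf_eq_zero_iff _ hU hz.1).1 h)
    have h3 := hGδ z hz.2
    rw [hk z hz.1] at h3
    have h4 : G z * (k z * Q.pf α z - 1) = 0 := by linear_combination -h3
    exact (mul_eq_zero.1 h4).resolve_left h2
  intro h0
  rw [(Q.pf_eq_zero_iff α hU' hxU').2 h0] at h1
  norm_num at h1

/-- The top degree form dual to the top power of a nondegenerate bivector. -/
lemma Bivector.exists_dual_form (hF : Module.finrank ℝ F = 2 * n) (hQ : ∀ x, Q.val x ^ n ≠ 0) :
    ∃ θ : ∀ x : X, (E x) [⋀^Fin (2 * n)]→ₗ[ℝ] ℝ,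
      (∀ v : Fin (2 * n) → Sec (2 * n) F E,
        ContMDiff (𝓡 (2 * n)) 𝓘(ℝ, ℝ) ∞ fun x => θ x fun i => v i x) ∧
      ∀ x (η : (E x) [⋀^Fin (2 * n)]→ₗ[ℝ] ℝ) (v : Fin (2 * n) → E x),
        η v = θ x v * formFunctional η (Q.val x ^ n) := by
  choose α s U hxU hU using exists_frame_of_finrank_eq E hF
  have hpf {x₀ x : X} (hx : x ∈ U x₀) : Q.pf (α x₀) x ≠ 0 := fun h =>
    hQ x ((Q.pf_eq_zero_iff _ (hU x₀) hx).1 h)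
  -- The frame form is normalized to pair to `1` with `Q^n`, which makes it independent of the
  -- frame; smoothness near `x₀` can thus be read in the frame chosen at `x₀`.
  let θ (x : X) : (E x) [⋀^Fin (2 * n)]→ₗ[ℝ] ℝ := (Q.pf (α x) x)⁻¹ • frameForm (α x) x
  have key (x : X) (η : (E x) [⋀^Fin (2 * n)]→ₗ[ℝ] ℝ) (v : Fin (2 * n) → E x) :
      η v = θ x v * formFunctional η (Q.val x ^ n) := by
    have h1 := congrArg (fun ζ : (E x) [⋀^Fin (2 * n)]→ₗ[ℝ] ℝ => ζ v)
      ((hU x).form_eq (hxU x) η)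
    have h2 := hpf (hxU x)
    rw [Q.formFunctional_pow (α x) (hU x) (hxU x)]
    change η v = (η fun i => s x i x) * frameForm (α x) x v at h1
    change η v = ((Q.pf (α x) x)⁻¹ * frameForm (α x) x v) * _
    rw [h1]
    field_simp
  refine ⟨θ, fun v x₀ => ?_, key⟩
  have h1 : ContMDiffAt (𝓡 (2 * n)) 𝓘(ℝ, ℝ) ∞
      (fun x => (frameForm (α x₀) x fun i => v i x) / Q.pf (α x₀) x) x₀ :=
    (frameForm_smooth (α x₀) v x₀).div₀ ((Q.pf (α x₀)).contMDiff x₀) (hpf (hxU x₀))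
  refine h1.congr_of_eventuallyEq ?_
  filter_upwards [(hU x₀).isOpen.mem_nhds (hxU x₀)] with x hx
  rw [key x (frameForm (α x₀) x), ← Q.pf_apply, mul_div_cancel_right₀ _ (hpf hx)]

lemma Bivector.exists_mem_ideal {η : ∀ x : X, (TangentSpace (𝓡 (2 * n)) x) [⋀^Fin (2 * n)]→ₗ[ℝ] ℝ}
    (hη : IsSmoothForm η) : ∃ f ∈ P.ideal, ∀ x, f x = formFunctional (η x) (P.val x ^ n) := by
  have h1 : ContMDiff (𝓡 (2 * n)) 𝓘(ℝ, ℝ) ∞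
      (fun x => formFunctional (η x) (P.val x ^ n)) := by
    intro x₀
    obtain ⟨x, D, U, hxU, hU⟩ := exists_coordinates (2 * n) x₀
    refine ContMDiffAt.congr_of_eventuallyEq
      ((hη D x₀).mul ((P.pf fun i => dcov (x i)).contMDiff x₀)) ?_
    filter_upwards [hU.isOpen.mem_nhds hxU] with y hy
    exact P.formFunctional_pow _ hU hy _
  exact ⟨⟨_, h1⟩, (P.mem_ideal_iff _).2 ⟨η, hη, fun _ => rfl⟩, fun _ => rfl⟩

/-- A basis can be extracted from the spanning family, and a nonzero top form does not vanish on a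
basis. -/
lemma exists_ne_zero_of_span {V : Type*} [AddCommGroup V] [Module ℝ V] [FiniteDimensional ℝ V]
    {m : ℕ} (hm : Module.finrank ℝ V = m) {κ : Type*} {v : κ → V}
    (hv : Submodule.span ℝ (Set.range v) = ⊤) {θ : V [⋀^Fin m]→ₗ[ℝ] ℝ} (hθ : θ ≠ 0) :
    ∃ J : Fin m → κ, θ (fun i => v (J i)) ≠ 0 := by
  have hm' : Module.finrank ℝ (Submodule.span ℝ (Set.range v)) = m := by
    rw [hv, finrank_top, hm]
  obtain ⟨w, hw, hspan, hli⟩ := Submodule.exists_fun_fin_finrank_span_eq ℝ (Set.range v)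
  subst hm'
  choose J hJ using hw
  refine ⟨J, fun h => hθ ?_⟩
  simp only [hJ] at h
  let b := Module.Basis.mk hli (hspan.trans hv).ge
  have hb : ⇑b = w := Module.Basis.coe_mk _ _
  rw [AlternatingMap.eq_smul_basis_det b θ, hb]
  exact (congrArg (· • b.det) h).trans (zero_smul _ _)

variable [SecondCountableTopology X]

/-- With `θ` dual to `Q^n`, one has `η(ρ v) = θ(v) ⟨P^n, η⟩`, which gives one inclusion at once. For
the other, `θ(v)` has to be inverted globally although no single tuple `v` need be a frame. -/
lemma divisorIdeal_eq_of_isNondegenerate (hF : Module.finrank ℝ F = 2 * n)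
    (hQ : A.IsLift Q P) (h : Q.IsNondegenerate) : A.divisorIdeal = P.ideal := by
  rw [Bivector.isNondegenerate_iff hF] at h
  obtain ⟨θ, hθ, hθη⟩ := Bivector.exists_dual_form hF h
  have key (x : X) (η : (TangentSpace (𝓡 (2 * n)) x) [⋀^Fin (2 * n)]→ₗ[ℝ] ℝ)
      (v : Fin (2 * n) → E x) :
      η (fun i => A.anchor x (v i)) = θ x v * formFunctional η (P.val x ^ n) := by
    rw [hQ.formFunctional_eq, ← hθη]
    rfl
  refine le_antisymm (Ideal.span_le.2 ?_) fun f hf => ?_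
  · rintro f ⟨v, η, hη, hf⟩
    obtain ⟨g, hg, hgη⟩ := Bivector.exists_mem_ideal (P := P) hη
    let c : SmoothFun (2 * n) X := ⟨_, hθ v⟩
    have h1 : f = c * g := by
      ext x
      rw [hf, key]
      change _ = _ * g x
      rw [hgη]
      rfl
    rw [h1]
    exact Ideal.mul_mem_left _ _ hg
  · obtain ⟨η, hη, hfη⟩ := (P.mem_ideal_iff f).1 hf
    obtain ⟨s, hs⟩ := exists_generators (2 * n) F E
    let φ (J : Fin (2 * n) → Fin 3 × Fin (2 * n + Module.finrank ℝ F)) : SmoothFun (2 * n) X :=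
      ⟨_, hθ fun i => s (J i)⟩
    have hφf (J) : φ J * f ∈ A.divisorIdeal :=
      Ideal.subset_span ⟨fun i => s (J i), η, hη, fun x => by
        rw [key x (η x), ← hfη]
        rfl⟩
    -- Some `φ J` is nonzero at each point because the generators span, so this sum of squares is a
    -- unit and `f = ∑ Φ⁻¹ φ_J (φ_J f)`.
    let Φ : SmoothFun (2 * n) X := ∑ J, φ J * φ J
    have hΦ (x : X) : Φ x ≠ 0 := by
      obtain ⟨α, t, U, hx, hU⟩ := exists_frame_of_finrank_eq E hF x
      have := (hU.basis hx).finiteDimensional_of_finite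
      have h1 : Module.finrank ℝ (E x) = 2 * n := by
        rw [Module.finrank_eq_card_basis (hU.basis hx), Fintype.card_fin]
      have h2 : Submodule.span ℝ (Set.range fun p => s p x) = ⊤ := by
        by_contra hne
        obtain ⟨β, hβ, hβs⟩ := Submodule.exists_dual_map_eq_bot_of_lt_top (lt_top_iff_ne_top.2 hne)
          inferInstance
        refine hβ (hs x trivial β fun p => ?_)
        have : β (s p x) ∈ Submodule.map β (Submodule.span ℝ (Set.range fun p => s p x)) :=
          Submodule.mem_map_of_mem (Submodule.subset_span ⟨p, rfl⟩)
        rwa [hβs, Submodule.mem_bot] at this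
      have h3 : θ x ≠ 0 := by
        intro h0
        refine h x (eq_zero_of_formFunctional (bivector_pow_mem (Q.val_mem x) n) fun ζ => ?_)
        have : ζ = 0 := AlternatingMap.ext fun v => by
          rw [hθη x ζ, h0, AlternatingMap.zero_apply, zero_mul]
        have h4 := formFunctional_smul 0 ζ _ (bivector_pow_mem (Q.val_mem x) n)
        rwa [zero_mul, zero_smul, ← this] at h4
      obtain ⟨J, hJ⟩ := exists_ne_zero_of_span h1 h2 h3
      have h4 : Φ x = ∑ J, φ J x * φ J x := SmoothFun.sum_apply _ _ _
      rw [h4]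
      exact (Finset.sum_pos' (fun J _ => mul_self_nonneg (φ J x))
        ⟨J, Finset.mem_univ _, mul_self_pos.2 hJ⟩).ne'
    let Ψ : SmoothFun (2 * n) X := ⟨fun x => (Φ x)⁻¹, Φ.contMDiff.inv₀ hΦ⟩
    have h5 : f = ∑ J, (Ψ * φ J) * (φ J * f) := by
      have h6 : ∑ J, (Ψ * φ J) * (φ J * f) = (Ψ * Φ) * f := by
        rw [Finset.mul_sum, Finset.sum_mul]
        exact Finset.sum_congr rfl fun J _ => by ring
      rw [h6]
      ext x
      change f x = (Φ x)⁻¹ * Φ x * f x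
      rw [inv_mul_cancel₀ (hΦ x), one_mul]
    rw [h5]
    exact Ideal.sum_mem _ fun J _ => Ideal.mul_mem_left _ _ (hφf J)

end Standard

end DivType

end

open DivType in
theorem theoremA (n : ℕ) (X : Type*) [TopologicalSpace X] [T2Space X] [SecondCountableTopology X]
    [ChartedSpace (EuclideanSpace ℝ (Fin (2 * n))) X] [IsManifold (𝓡 (2 * n)) ∞ X]
    (F : Type*) [NormedAddCommGroup F] [NormedSpace ℝ F] [FiniteDimensional ℝ F]
    (E : X → Type*) [TopologicalSpace (TotalSpace F E)] [∀ x, TopologicalSpace (E x)]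
    [∀ x, AddCommGroup (E x)] [∀ x, Module ℝ (E x)] [FiberBundle F E] [VectorBundle ℝ F E]
    [ContMDiffVectorBundle ∞ F E (𝓡 (2 * n))]
    (I : Ideal (SmoothFun (2 * n) X)) (hI : IsDivisorIdeal I)
    (A : LieAlgebroid (2 * n) X F E) (hA : A.IsIdealLieAlgebroid I)
    (hclosed : A.HasLocalClosedBases)
    (P : BivectorField (2 * n) X) (hP : (tangent (2 * n) X).IsPoisson P)
    (hPI : Bivector.IsOfDivisorType P I) :
    A.IsDivisorType ∧
    ∃ PA : Bivector (2 * n) F E, A.IsPoisson PA ∧ A.IsLift PA P ∧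
      (∀ σ : Bivector (2 * n) F E, A.IsLift σ P → σ = PA) ∧
      (PA.IsNondegenerate ↔ A.divisorIdeal = I) := by
  obtain ⟨hnd, rfl⟩ := hPI
  have hD := Bivector.dense_pow_ne_zero hnd
  have hbij : ∀ x ∈ {x : X | P.val x ^ n ≠ 0}, Function.Bijective (A.anchor x) :=
    fun x hx => Bivector.anchor_bijective hI hA hx
  obtain ⟨PA, hPA⟩ := A.exists_isLift hD hbij P (Bivector.exists_local_lift hI hA hP hD)
  refine ⟨hD.mono hbij, PA, A.isPoisson_of_isLift hD hbij hPA hP, hPA, fun σ hσ => ?_, ?_⟩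
  · refine Bivector.ext_val fun x => A.val_eq_of_map_eq isOpen_univ hD hbij (fun y _ => ?_)
      (Set.mem_univ x)
    rw [(A.isLift_iff _ _).1 hσ, (A.isLift_iff _ _).1 hPA]
  -- The rank of the bundle is found at a point where the anchor is bijective, so empty `X` is
  -- treated separately.
  · rcases isEmpty_or_nonempty X with hX | hX
    · have : Subsingleton (SmoothFun (2 * n) X) := ⟨fun f g => by ext x; exact hX.elim x⟩
      exact iff_of_true (fun x => hX.elim x) (Ideal.ext fun f => by
        rw [Subsingleton.elim f 0]
        exact iff_of_true (zero_mem _) (zero_mem _))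
    · obtain ⟨x, hx⟩ := hD.nonempty
      have hF := LieAlgebroid.finrank_eq (hbij x hx)
      exact ⟨divisorIdeal_eq_of_isNondegenerate hF hPA,
        fun h => isNondegenerate_of_divisorIdeal_le hF hD hPA h.le⟩
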